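/- Let $p$ be a prime, let $|\cdot|_p$ be the $p$-adic norm on $\mathbb{Q}_p$, and let $L^2(\mathbb{Q}_p)$ be taken with respect to the Haar measure for which $\mathbb{Z}_p$ has measure $1$. Let $D_0(\mathbb{Q}_p)$ be the space of locally constant functions $\mathbb{Q}_p\to\mathbb{C}$ with compact support and integral $0$. For $m\in\mathbb{Z}$, the elements of $\mathbb{Q}_p/p^{m}\mathbb{Z}_p$ are identified with their representatives $n=\sum_{l=-\delta}^{m-1}n_l p^l$, $n_l\in\{0,\dots,p-1\}$. Let $\chi(x)=e^{2\pi i\{x\}_p}$, where $\{x\}_p=\sum_{l<0}x_lp^l$ is the fractional part of $x=\sum_l x_lp^l$ ($0\le x_l<p$). For $\gamma\in\mathbb{Z}$, $n\in\mathbb{Q}_p/\mathbb{Z}_p$ and $j\in\{1,\dots,p-1\}$ define the $p$-adic wavelet $$\psi_{\gamma nj}(x)=p^{-\gamma/2}\,\chi\bigl(p^{-1}j(p^{\gamma}x-n)\bigr)\,\mathbf{1}_{\{|p^{\gamma}x-n|_p\le 1\}} .$$ The affine group $\{(a,b): a,b\in\mathbb{Q}_p,\ a\neq 0\}$, with product $(a,b)(a',b')=(aa',b+ab')$,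 acts on functions by $$G(a,b)f(x)=|a|_p^{-1/2}f\Bigl(\frac{x-b}{a}\Bigr).$$ Let $f\in D_0(\mathbb{Q}_p)$, $f\ne 0$, have the finite wavelet expansion $$f=\sum_{\gamma,n,j}C_{\gamma nj}\psi_{\gamma nj},\qquad C_{\gamma nj}\in\mathbb{C},$$ and suppose that $f$ is generic, i.e. that the stabilizer of $f$ in the affine group is the intersection of the stabilizers of the wavelets $\psi_{\gamma nj}$ with $C_{\gamma nj}\neq 0$. Let $\gamma_0$ be the minimal $\gamma$ for which some $C_{\gamma nj}\ne 0$, and let $\gamma_A$ be the positive integer defined by $$p^{-\gamma_A}=\min\left[p^{-1},\ \frac{\max(p^{\gamma_i-1},p^{\gamma_k-1})}{|p^{-\gamma_i}n_i-p^{-\gamma_k}n_k|_p}\right],$$ where the minimum runs over all pairs $(\gamma_i,n_i)$, $(\gamma_k,n_k)$ that occur in the expansion with nonzero coefficients and satisfy $p^{-\gamma_i}n_i\neq p^{-\gamma_k}n_k$. Then: 1) The map $$(\gamma,n,J)\longmapsto f^{(\gamma nJ)}=G(p^{\gamma}J,\,p^{\gamma}Jn)f,$$ where $\gamma\in\mathbb{Z}$,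 $n\in\mathbb{Q}_p/p^{1-\gamma_0}\mathbb{Z}_p$ and $J=j_0+j_1p+\dots+j_{\gamma_A-1}p^{\gamma_A-1}$ with $j_0\in\{1,\dots,p-1\}$ and $j_i\in\{0,\dots,p-1\}$ for $i\ge 1$, is a one-to-one parametrization of the orbit of $f$ under the affine group. 2) The orbit of $f$ is a uniform tight frame in $L^2(\mathbb{Q}_p)$: all $f^{(\gamma nJ)}$ have the same $L^2$-norm, and for every $g\in L^2(\mathbb{Q}_p)$ $$\sum_{\gamma,n,J}|\langle g,f^{(\gamma nJ)}\rangle|^2=\|g\|^2\sum_{\gamma,n,j}|C_{\gamma nj}|^2\,p^{\gamma_A-\gamma_0+\gamma},$$ where the frame constant $\sum_{\gamma,n,j}|C_{\gamma nj}|^2p^{\gamma_A-\gamma_0+\gamma}$ is positive. -/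

import Mathlib

open MeasureTheory

namespace PadicWavelet

noncomputable section

/-! ### Haar measure on `ℚ_p` -/

instance instMeasurableSpacePadic (p : ℕ) [Fact p.Prime] : MeasurableSpace ℚ_[p] := borel _

instance instBorelSpacePadic (p : ℕ) [Fact p.Prime] : BorelSpace ℚ_[p] := ⟨rfl⟩

/-- The closed unit ball `{x : |x|_p ≤ 1}` as a compact set with non-empty interior. -/
def unitBall (p : ℕ) [Fact p.Prime] : TopologicalSpace.PositiveCompacts ℚ_[p] where
  carrier := Metric.closedBall 0 1
  isCompact' := isCompact_closedBall 0 1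
  interior_nonempty' :=
    ⟨0, interior_mono Metric.ball_subset_closedBall
      (by rw [Metric.isOpen_ball.interior_eq]; exact Metric.mem_ball_self one_pos)⟩

/-- The Haar measure on `ℚ_p`, normalized so that the unit ball has volume one. -/
def haar (p : ℕ) [Fact p.Prime] : Measure ℚ_[p] := Measure.addHaarMeasure (unitBall p)

instance instIsAddHaarMeasureHaar (p : ℕ) [Fact p.Prime] : (haar p).IsAddHaarMeasure := by
  unfold haar; infer_instance

/-- The Hilbert space `L²(ℚ_p)`. -/
abbrev L2 (p : ℕ) [Fact p.Prime] : Type := Lp ℂ 2 (haar p)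

/-! ### The additive character, representatives and wavelets -/

theorem norm_pow_toNat_mul_le (p : ℕ) [hp : Fact p.Prime] (x : ℚ_[p]) :
    ‖(p : ℚ_[p]) ^ (-x.valuation).toNat * x‖ ≤ 1 := by
  by_cases hx : x = 0
  · simp [hx]
  have h1 : (1 : ℝ) < p := by exact_mod_cast hp.out.one_lt
  rw [norm_mul, norm_pow, Padic.norm_p, Padic.norm_eq_zpow_neg_valuation hx, inv_pow,
    ← zpow_natCast, ← zpow_neg, ← zpow_add₀ (by positivity)]
  apply zpow_le_one_of_nonpos₀ h1.le
  omega

/-- The fractional part `∑_{l < 0} x_l p^l` of the `p`-adic number `x = ∑_l x_l p^l`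
(with digits `0 ≤ x_l < p`): for `x = p^(-δ) z` with `z ∈ ℤ_p` this is `(z mod p^δ) / p^δ`. -/
def fracPart (p : ℕ) [Fact p.Prime] (x : ℚ_[p]) : ℚ :=
  (PadicInt.appr ⟨(p : ℚ_[p]) ^ (-x.valuation).toNat * x, norm_pow_toNat_mul_le p x⟩
    (-x.valuation).toNat : ℚ) / (p : ℚ) ^ (-x.valuation).toNat

theorem fracPart_nonneg (p : ℕ) [Fact p.Prime] (x : ℚ_[p]) : 0 ≤ fracPart p x := by
  unfold fracPart; positivity

theorem fracPart_lt_one (p : ℕ) [hp : Fact p.Prime] (x : ℚ_[p]) : fracPart p x < 1 := by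
  have h0 : (0 : ℚ) < p := by exact_mod_cast hp.out.pos
  unfold fracPart
  rw [div_lt_one (by positivity)]
  exact_mod_cast PadicInt.appr_lt _ _

theorem norm_sub_fracPart_le (p : ℕ) [hp : Fact p.Prime] (x : ℚ_[p]) :
    ‖x - (fracPart p x : ℚ_[p])‖ ≤ 1 := by
  have h0 : (p : ℚ_[p]) ≠ 0 := by exact_mod_cast hp.out.ne_zero
  unfold fracPart
  set δ := (-x.valuation).toNat
  set z : ℤ_[p] := ⟨(p : ℚ_[p]) ^ δ * x, norm_pow_toNat_mul_le p x⟩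
  have h := PadicInt.appr_spec δ z
  obtain ⟨w, hw⟩ := Ideal.mem_span_singleton.1 h
  have hw' : (p : ℚ_[p]) ^ δ * x - (z.appr δ : ℚ_[p]) = (p : ℚ_[p]) ^ δ * (w : ℚ_[p]) := by
    have := congrArg (fun t : ℤ_[p] => (t : ℚ_[p])) hw
    rw [PadicInt.coe_sub, PadicInt.coe_mul, PadicInt.coe_natCast, PadicInt.coe_pow,
      PadicInt.coe_natCast] at this
    exact this
  have : x - (((z.appr δ : ℚ) / (p : ℚ) ^ δ : ℚ) : ℚ_[p]) = (w : ℚ_[p]) := by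
    push_cast
    field_simp
    linear_combination hw'
  rw [this]
  exact w.2

/-- The additive character `χ(x) = exp(2πi {x}_p)` of `ℚ_p`. -/
def chi (p : ℕ) [Fact p.Prime] (x : ℚ_[p]) : ℂ :=
  Complex.exp (2 * Real.pi * Complex.I * (fracPart p x : ℂ))

/-- The standard representatives `∑_{l = -δ}^{m-1} n_l p^l`, `0 ≤ n_l ≤ p - 1`, of the elements
of the quotient group `ℚ_p / p^m ℤ_p`. -/
def reps (p : ℕ) [Fact p.Prime] (m : ℤ) : Set ℚ_[p] :=
  {x | ∃ (δ : ℤ) (d : ℤ → ℕ), (∀ l, d l < p) ∧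
    x = ∑ l ∈ Finset.Ico (-δ) m, (d l : ℚ_[p]) * (p : ℚ_[p]) ^ l}

/-- Indices `(γ, n, j)` of the wavelet basis: `γ ∈ ℤ`, `n` a standard representative of an element
of `ℚ_p / ℤ_p`, and `j ∈ {1, …, p - 1}`. -/
structure WaveletIndex (p : ℕ) [Fact p.Prime] where
  scale : ℤ
  shift : ℚ_[p]
  shift_mem : shift ∈ reps p 0
  freq : ℕ
  freq_mem : freq ∈ Finset.Icc 1 (p - 1)

open scoped Classical in
/-- The wavelet `ψ_{γnj}(x) = p^{-γ/2} χ(p^{-1} j (p^γ x - n)) Ω(|p^γ x - n|_p)`. -/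
def wavelet {p : ℕ} [Fact p.Prime] (i : WaveletIndex p) (x : ℚ_[p]) : ℂ :=
  if ‖(p : ℚ_[p]) ^ i.scale * x - i.shift‖ ≤ 1 then
    (((p : ℝ) ^ (-(i.scale : ℝ) / 2) : ℝ) : ℂ) *
      chi p ((p : ℚ_[p])⁻¹ * (i.freq : ℚ_[p]) * ((p : ℚ_[p]) ^ i.scale * x - i.shift))
  else 0

/-! ### The affine group and its action on functions -/

/-- The affine group of `ℚ_p`: pairs `(a, b)` with `a ≠ 0`. -/
@[ext]
structure AffGroup (p : ℕ) [Fact p.Prime] where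
  a : ℚ_[p]
  b : ℚ_[p]
  a_ne_zero : a ≠ 0

instance instGroupAffGroup (p : ℕ) [Fact p.Prime] : Group (AffGroup p) where
  mul g h := ⟨g.a * h.a, g.b + g.a * h.b, mul_ne_zero g.a_ne_zero h.a_ne_zero⟩
  one := ⟨1, 0, one_ne_zero⟩
  inv g := ⟨g.a⁻¹, -g.b * g.a⁻¹, inv_ne_zero g.a_ne_zero⟩
  mul_assoc g h k := by
    apply AffGroup.ext
    · exact mul_assoc g.a h.a k.a
    · change g.b + g.a * h.b + g.a * h.a * k.b = g.b + g.a * (h.b + h.a * k.b)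
      ring
  one_mul g := by
    apply AffGroup.ext
    · exact one_mul g.a
    · change 0 + 1 * g.b = g.b
      ring
  mul_one g := by
    apply AffGroup.ext
    · exact mul_one g.a
    · change g.b + g.a * 0 = g.b
      ring
  inv_mul_cancel g := by
    apply AffGroup.ext
    · exact inv_mul_cancel₀ g.a_ne_zero
    · change -g.b * g.a⁻¹ + g.a⁻¹ * g.b = 0
      ring

/-- The action `G(a,b) f (x) = |a|_p^{-1/2} f((x - b)/a)` of the affine group on functions. -/
instance instMulActionAffGroup (p : ℕ) [Fact p.Prime] : MulAction (AffGroup p) (ℚ_[p] → ℂ) where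
  smul g f := fun x => ((‖g.a‖ ^ (-(1 / 2) : ℝ) : ℝ) : ℂ) * f ((x - g.b) / g.a)
  one_smul f := by
    funext x
    change ((‖(1 : ℚ_[p])‖ ^ (-(1 / 2) : ℝ) : ℝ) : ℂ) * f ((x - 0) / 1) = f x
    simp
  mul_smul g h f := by
    funext x
    change ((‖g.a * h.a‖ ^ (-(1 / 2) : ℝ) : ℝ) : ℂ) *
        f ((x - (g.b + g.a * h.b)) / (g.a * h.a)) =
      ((‖g.a‖ ^ (-(1 / 2) : ℝ) : ℝ) : ℂ) * (((‖h.a‖ ^ (-(1 / 2) : ℝ) : ℝ) : ℂ) *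
        f (((x - g.b) / g.a - h.b) / h.a))
    have hg := g.a_ne_zero
    have hh := h.a_ne_zero
    rw [norm_mul, Real.mul_rpow (norm_nonneg _) (norm_nonneg _)]
    have : (x - (g.b + g.a * h.b)) / (g.a * h.a) = ((x - g.b) / g.a - h.b) / h.a := by
      field_simp
      ring
    rw [this]
    push_cast
    ring

theorem smul_apply {p : ℕ} [Fact p.Prime] (g : AffGroup p) (f : ℚ_[p] → ℂ) (x : ℚ_[p]) :
    (g • f) x = ((‖g.a‖ ^ (-(1 / 2) : ℝ) : ℝ) : ℂ) * f ((x - g.b) / g.a) := rfl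

/-! ### Mean zero test functions -/

/-- The space `D₀(ℚ_p)` of locally constant functions with compact support and mean zero. -/
def D0 (p : ℕ) [Fact p.Prime] : Submodule ℂ (ℚ_[p] → ℂ) where
  carrier := {f | IsLocallyConstant f ∧ HasCompactSupport f ∧ ∫ x, f x ∂(haar p) = 0}
  zero_mem' := ⟨IsLocallyConstant.const 0, HasCompactSupport.zero, by simp⟩
  add_mem' := by
    rintro f g ⟨hf1, hf2, hf3⟩ ⟨hg1, hg2, hg3⟩
    refine ⟨hf1.add hg1, hf2.add hg2, ?_⟩
    have := integral_add (hf1.continuous.integrable_of_hasCompactSupport (μ := haar p) hf2)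
      (hg1.continuous.integrable_of_hasCompactSupport (μ := haar p) hg2)
    simpa [hf3, hg3] using this
  smul_mem' := by
    rintro c f ⟨hf1, hf2, hf3⟩
    refine ⟨hf1.comp (fun z => c • z), ?_, ?_⟩
    · exact HasCompactSupport.comp_left (g := fun z : ℂ => c • z) hf2 (smul_zero c)
    · simp only [Pi.smul_apply]
      rw [integral_smul, hf3, smul_zero]

theorem memLp_of_mem_D0 {p : ℕ} [Fact p.Prime] {f : ℚ_[p] → ℂ} (hf : f ∈ D0 p) :
    MemLp f 2 (haar p) :=
  hf.1.continuous.memLp_of_hasCompactSupport hf.2.1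

theorem smul_mem_D0 {p : ℕ} [Fact p.Prime] (g : AffGroup p) {f : ℚ_[p] → ℂ} (hf : f ∈ D0 p) :
    g • f ∈ D0 p := by
  obtain ⟨hf1, hf2, hf3⟩ := hf
  have ha := g.a_ne_zero
  let e : ℚ_[p] ≃ₜ ℚ_[p] := (Homeomorph.subRight g.b).trans (Homeomorph.mulRight₀ g.a⁻¹
    (inv_ne_zero ha))
  have he : ∀ x, e x = (x - g.b) / g.a := fun x => by
    simp [e, div_eq_mul_inv]
  have hcomp : g • f = (fun z => ((‖g.a‖ ^ (-(1 / 2) : ℝ) : ℝ) : ℂ) * z) ∘ (f ∘ e) := by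
    funext x
    simp [smul_apply, he]
  refine ⟨?_, ?_, ?_⟩
  · rw [hcomp]
    exact (hf1.comp_continuous e.continuous).comp _
  · rw [hcomp]
    exact (hf2.comp_homeomorph e).comp_left (mul_zero _)
  · have hm : ((haar p).map (fun x : ℚ_[p] => x / g.a)).IsAddHaarMeasure := by
      let φ : ℚ_[p] ≃+ ℚ_[p] :=
        { (Homeomorph.mulRight₀ g.a⁻¹ (inv_ne_zero ha)).toEquiv with
          map_add' := fun x y => add_mul x y _ }
      have := φ.isAddHaarMeasure_map (haar p)
        (Homeomorph.mulRight₀ g.a⁻¹ (inv_ne_zero ha)).continuous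
        (Homeomorph.mulRight₀ g.a⁻¹ (inv_ne_zero ha)).symm.continuous
      have h2 : (φ : ℚ_[p] → ℚ_[p]) = fun x : ℚ_[p] => x / g.a := by
        funext x; rw [div_eq_mul_inv]; rfl
      rwa [h2] at this
    have hs : ∫ x, f (x / g.a) ∂(haar p) = 0 := by
      have h1 : ∫ x, f (x / g.a) ∂(haar p) =
          ∫ y, f y ∂((haar p).map (fun x : ℚ_[p] => x / g.a)) := by
        rw [integral_map (by fun_prop)]
        exact hf1.continuous.aestronglyMeasurable
      rw [h1, Measure.isAddLeftInvariant_eq_smul ((haar p).map (fun x : ℚ_[p] => x / g.a)) (haar p),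
        integral_smul_nnreal_measure, hf3, smul_zero]
    simp only [smul_apply]
    rw [integral_const_mul, integral_sub_right_eq_self (fun x => f (x / g.a)), hs, mul_zero]

/-- The inclusion `D₀(ℚ_p) → L²(ℚ_p)`. -/
def toL2 {p : ℕ} [Fact p.Prime] (f : ℚ_[p] → ℂ) (hf : f ∈ D0 p) : L2 p :=
  (memLp_of_mem_D0 hf).toLp f

theorem mem_D0_of_mem_orbit {p : ℕ} [Fact p.Prime] {f u : ℚ_[p] → ℂ} (hf : f ∈ D0 p)
    (hu : u ∈ MulAction.orbit (AffGroup p) f) : u ∈ D0 p := by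
  obtain ⟨g, rfl⟩ := hu
  exact smul_mem_D0 g hf

/-- `f` is generic (with respect to its wavelet expansion with coefficients `C`): its stabilizer is
the intersection of the stabilizers of the wavelets that contribute to the expansion. -/
def IsGeneric {p : ℕ} [Fact p.Prime] (f : ℚ_[p] → ℂ) (C : WaveletIndex p →₀ ℂ) : Prop :=
  MulAction.stabilizer (AffGroup p) f =
    ⨅ i ∈ C.support, MulAction.stabilizer (AffGroup p) (wavelet i)

/-! ### Parameters of the orbit -/

/-- The scales `γ` occurring in the expansion with coefficients `C`. -/
def scales {p : ℕ} [Fact p.Prime] (C : WaveletIndex p →₀ ℂ) : Set ℤ :=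
  {γ | ∃ i ∈ C.support, γ = i.scale}

/-- The set of numbers consisting of `p^{-1}` and of the quotients
`max(p^{γ_i - 1}, p^{γ_j - 1}) / |p^{-γ_i} n_i - p^{-γ_j} n_j|_p` over all pairs of wavelets
contributing to the expansion for which `p^{-γ_i} n_i ≠ p^{-γ_j} n_j`. -/
def radii {p : ℕ} [Fact p.Prime] (C : WaveletIndex p →₀ ℂ) : Set ℝ :=
  {(p : ℝ)⁻¹} ∪
    {r | ∃ i ∈ C.support, ∃ k ∈ C.support,
      (p : ℚ_[p]) ^ (-i.scale) * i.shift - (p : ℚ_[p]) ^ (-k.scale) * k.shift ≠ 0 ∧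
      r = max ((p : ℝ) ^ (i.scale - 1)) ((p : ℝ) ^ (k.scale - 1)) /
        ‖(p : ℚ_[p]) ^ (-i.scale) * i.shift - (p : ℚ_[p]) ^ (-k.scale) * k.shift‖}

/-- Indices `(γ, n, J)` of the orbit: `γ ∈ ℤ`, `n` a standard representative of an element of
`ℚ_p / p^{1-γ₀} ℤ_p`, and `J = j + j_1 p + ⋯ + j_{γA-1} p^{γA-1}` with digits `0 ≤ j_i ≤ p - 1` and
`j ≠ 0`, i.e. `0 ≤ J < p^{γA}` and `p ∤ J`. -/
structure OrbitIndex (p : ℕ) [Fact p.Prime] (γ₀ : ℤ) (γA : ℕ) where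
  scale : ℤ
  shift : ℚ_[p]
  shift_mem : shift ∈ reps p (1 - γ₀)
  dil : ℕ
  dil_lt : dil < p ^ γA
  not_dvd_dil : ¬ p ∣ dil

/-- The element `G(p^γ J, p^γ J n)` of the affine group. -/
def OrbitIndex.elt {p : ℕ} [hp : Fact p.Prime] {γ₀ : ℤ} {γA : ℕ} (t : OrbitIndex p γ₀ γA) :
    AffGroup p where
  a := (p : ℚ_[p]) ^ t.scale * (t.dil : ℚ_[p])
  b := (p : ℚ_[p]) ^ t.scale * (t.dil : ℚ_[p]) * t.shift
  a_ne_zero := by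
    have h0 : t.dil ≠ 0 := fun h => t.not_dvd_dil (h ▸ dvd_zero p)
    exact mul_ne_zero (zpow_ne_zero _ (by exact_mod_cast hp.out.ne_zero)) (by exact_mod_cast h0)

/-! ### Frames -/

/-- A family `v` of vectors of a Hilbert space is a uniform tight frame with frame constant `A`:
all its elements have the same norm, and `∑_i |⟨g, v_i⟩|² = A ‖g‖²` for every vector `g`,
where `A > 0`. -/
structure IsUniformTightFrame {H : Type*} [NormedAddCommGroup H] [InnerProductSpace ℂ H]
    {ι : Type*} (v : ι → H) (A : ℝ) : Prop where
  pos : 0 < A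
  norm_eq : ∀ i k, ‖v i‖ = ‖v k‖
  hasSum : ∀ g : H, HasSum (fun i => ‖inner ℂ g (v i)‖ ^ 2) (A * ‖g‖ ^ 2)

end

end PadicWavelet

/-! Every wavelet is G(e)ψ for the single function ψ(x) = χ(x/p) on the unit ball
(`wavelet_eq_smul_psi`), so the problem is about coherent states G(g)ψ. The subgroup K of all (a,b)
with |a-1| < 1, |b| ≤ 1 acts on ψ by the character λ(a,b) = χ(-b/p) (`smul_psi`, `lam_mul`). If h is
not in K, then λ and its conjugate by h differ somewhere on K ∩ hKh⁻¹, so unitarity forces G(h)ψ ⊥ ψ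
(`inner_coherent_one_eq_zero`). The coherent states are also total
(`eq_zero_of_orthogonal_coherent`). Hence for a wavelet ψ_i = G(e_i)ψ the cosets of L_i = e_i K
e_i⁻¹ index an orthonormal basis up to phases, and Parseval's identity is a sum over G/L_i
(`hasSum_norm_inner_coherent`).

Genericity makes the stabilizer S of f an explicit "ball" in the affine group
(`iInf_stabilizer_wavelet`). Reading off its left cosets in coordinates gives the parametrization
(`OrbitIndex.inv_elt_mul_mem_iff`, `bijective_orbitIndex`).

By orbit-stabilizer the frame sum is a sum over G/S of |∑ C_i ⟨g, G(q)ψ_i⟩|². In a diagonal term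
each coset of L_i is counted [L_i : S] = p^(γ_A - γ₀ + γ_i) times; this index is a ratio of Haar
volumes (`relIndex_affBall`). A cross term i ≠ k transforms under L_i ∩ L_k by a nontrivial
character that is trivial on S, so it sums to zero (`hasSum_quotient_zero`). Adding up gives the
frame constant (`hasSum_norm_inner_quotient`). -/

namespace PadicWavelet

variable {p : ℕ} [hp : Fact p.Prime]

/-! ### Norms on `ℚ_p` -/

theorem one_lt_prime : (1 : ℝ) < p := by exact_mod_cast hp.out.one_lt

theorem prime_pos : (0 : ℝ) < p := one_pos.trans one_lt_prime

theorem prime_ne_zero : (p : ℚ_[p]) ≠ 0 := by exact_mod_cast hp.out.ne_zero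

theorem norm_add_le_of_le {x y : ℚ_[p]} {r : ℝ} (hx : ‖x‖ ≤ r) (hy : ‖y‖ ≤ r) : ‖x + y‖ ≤ r :=
  (Padic.nonarchimedean x y).trans (max_le hx hy)

theorem norm_sub_le_of_le {x y : ℚ_[p]} {r : ℝ} (hx : ‖x‖ ≤ r) (hy : ‖y‖ ≤ r) : ‖x - y‖ ≤ r := by
  rw [sub_eq_add_neg]
  exact norm_add_le_of_le hx (by rwa [norm_neg])

theorem norm_le_inv_prime_iff (x : ℚ_[p]) : ‖x‖ ≤ (p : ℝ)⁻¹ ↔ ‖x‖ < 1 := by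
  have := Padic.norm_lt_pow_iff_norm_le_pow_sub_one x 0
  simpa using this.symm

theorem norm_eq_one_of_norm_sub_one_lt {a : ℚ_[p]} (h : ‖a - 1‖ < 1) : ‖a‖ = 1 := by
  have := Padic.norm_eq_of_norm_sub_lt_right (z1 := a) (z2 := 1) (by simpa using h)
  simpa using this

theorem exists_norm_eq_zpow {x : ℚ_[p]} (hx : x ≠ 0) : ∃ n : ℤ, ‖x‖ = (p : ℝ) ^ n :=
  ⟨_, Padic.norm_eq_zpow_neg_valuation hx⟩

theorem exists_natCast_norm_sub_le {x : ℚ_[p]} (hx : ‖x‖ ≤ 1) (N : ℕ) :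
    ∃ k : ℕ, k < p ^ N ∧ ‖x - k‖ ≤ (p : ℝ) ^ (-(N : ℤ)) := by
  obtain ⟨z, rfl⟩ : ∃ z : ℤ_[p], (z : ℚ_[p]) = x := ⟨⟨x, hx⟩, rfl⟩
  refine ⟨z.appr N, PadicInt.appr_lt _ _, ?_⟩
  obtain ⟨w, hw⟩ := Ideal.mem_span_singleton.1 (PadicInt.appr_spec N z)
  have hw' : (z : ℚ_[p]) - (z.appr N : ℚ_[p]) = (p : ℚ_[p]) ^ N * (w : ℚ_[p]) := by
    have := congrArg (fun t : ℤ_[p] => (t : ℚ_[p])) hw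
    rwa [PadicInt.coe_sub, PadicInt.coe_mul, PadicInt.coe_natCast, PadicInt.coe_pow,
      PadicInt.coe_natCast] at this
  rw [hw', norm_mul, Padic.norm_p_pow]
  exact mul_le_of_le_one_right (by positivity) w.2

theorem natCast_eq_of_norm_sub_le {N k l : ℕ} (hk : k < p ^ N) (hl : l < p ^ N)
    (h : ‖(k : ℚ_[p]) - l‖ ≤ (p : ℝ) ^ (-(N : ℤ))) : k = l := by
  have h1 : ‖(((k : ℤ) - (l : ℤ) : ℤ) : ℚ_[p])‖ ≤ (p : ℝ) ^ (-(N : ℤ)) := by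
    push_cast
    exact h
  rw [Padic.norm_int_le_pow_iff_dvd] at h1
  have h2 := Int.eq_zero_of_abs_lt_dvd h1 (by
    have hk' : (k : ℤ) < (p : ℤ) ^ N := by exact_mod_cast hk
    have hl' : (l : ℤ) < (p : ℤ) ^ N := by exact_mod_cast hl
    rw [abs_lt]
    constructor <;> omega)
  omega

/-! ### The additive character -/

/-- Rational numbers whose denominator is a power of `p`. -/
def IsPFraction (p : ℕ) (q : ℚ) : Prop := ∃ (m : ℤ) (N : ℕ), q = m / (p : ℚ) ^ N

theorem IsPFraction.add {q r : ℚ} (hq : IsPFraction p q) (hr : IsPFraction p r) :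
    IsPFraction p (q + r) := by
  obtain ⟨m, N, rfl⟩ := hq
  obtain ⟨m', N', rfl⟩ := hr
  have h0 : (p : ℚ) ≠ 0 := by exact_mod_cast hp.out.ne_zero
  refine ⟨m * p ^ N' + m' * p ^ N, N + N', ?_⟩
  push_cast
  rw [pow_add]
  field_simp

theorem IsPFraction.neg {p : ℕ} {q : ℚ} (hq : IsPFraction p q) : IsPFraction p (-q) := by
  obtain ⟨m, N, rfl⟩ := hq
  exact ⟨-m, N, by push_cast; ring⟩

theorem isPFraction_fracPart (x : ℚ_[p]) : IsPFraction p (fracPart p x) :=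
  ⟨PadicInt.appr ⟨(p : ℚ_[p]) ^ (-x.valuation).toNat * x, norm_pow_toNat_mul_le p x⟩
    (-x.valuation).toNat, _, by rw [fracPart, Int.cast_natCast]⟩

/-- This is ℤ[1/p] ∩ ℤ_p = ℤ. -/
theorem IsPFraction.exists_int {q : ℚ} (hq : IsPFraction p q) (h : ‖(q : ℚ_[p])‖ ≤ 1) :
    ∃ k : ℤ, q = k := by
  obtain ⟨m, N, rfl⟩ := hq
  have h0 : (p : ℚ) ≠ 0 := by exact_mod_cast hp.out.ne_zero
  have h1 : ‖(m : ℚ_[p])‖ ≤ (p : ℝ) ^ (-(N : ℤ)) := by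
    push_cast at h
    rw [norm_div, Padic.norm_p_pow, div_le_one (zpow_pos prime_pos _)] at h
    exact h
  obtain ⟨k, rfl⟩ := (Padic.norm_int_le_pow_iff_dvd _ _).1 h1
  exact ⟨k, by push_cast; field_simp⟩

/-- Two p-fractions approximating x modulo ℤ_p differ by an element of ℤ[1/p] ∩ ℤ_p = ℤ, which the
exponential does not see. Additivity of χ thus needs no discussion of carries between digits. -/
theorem chi_eq_exp {x : ℚ_[p]} {q : ℚ} (hq : IsPFraction p q) (h : ‖x - (q : ℚ_[p])‖ ≤ 1) :
    chi p x = Complex.exp (2 * Real.pi * Complex.I * (q : ℂ)) := by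
  obtain ⟨k, hk⟩ := ((isPFraction_fracPart x).add hq.neg).exists_int (by
    have := norm_sub_le_of_le h (norm_sub_fracPart_le p x)
    convert this using 2
    push_cast
    ring)
  have hk' : fracPart p x = q + k := by linarith
  rw [chi, hk', Complex.exp_eq_exp_iff_exists_int]
  exact ⟨k, by push_cast; ring⟩

theorem chi_add (x y : ℚ_[p]) : chi p (x + y) = chi p x * chi p y := by
  rw [chi_eq_exp ((isPFraction_fracPart x).add (isPFraction_fracPart y)) (x := x + y), chi, chi,
    ← Complex.exp_add]
  · congr 1
    push_cast
    ring
  · have := norm_add_le_of_le (norm_sub_fracPart_le p x) (norm_sub_fracPart_le p y)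
    convert this using 2
    push_cast
    ring

theorem chi_eq_one_iff {x : ℚ_[p]} : chi p x = 1 ↔ ‖x‖ ≤ 1 := by
  constructor
  · intro h
    rw [chi, Complex.exp_eq_one_iff] at h
    obtain ⟨n, hn⟩ := h
    have h1 : (fracPart p x : ℂ) = n :=
      mul_left_cancel₀ Complex.two_pi_I_ne_zero (hn.trans (mul_comm _ _))
    have h2 : fracPart p x = (n : ℚ) := by exact_mod_cast h1
    have h3 := fracPart_nonneg p x
    have h4 := fracPart_lt_one p x
    rw [h2] at h3 h4
    have h5 : n = 0 := by
      have : 0 ≤ n := by exact_mod_cast h3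
      have : n < 1 := by exact_mod_cast h4
      omega
    have h6 := norm_sub_fracPart_le p x
    rw [h2, h5] at h6
    simpa using h6
  · intro h
    rw [chi_eq_exp (q := 0) ⟨0, 0, by simp⟩ (by simpa using h)]
    simp

theorem chi_zero : chi p 0 = 1 := chi_eq_one_iff.2 (by simp)

theorem norm_chi (x : ℚ_[p]) : ‖chi p x‖ = 1 := by
  rw [chi, show (2 * Real.pi * Complex.I * (fracPart p x : ℂ) : ℂ) =
    ((2 * Real.pi * (fracPart p x : ℝ) : ℝ) : ℂ) * Complex.I by push_cast; ring]
  exact Complex.norm_exp_ofReal_mul_I _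

theorem chi_ne_zero (x : ℚ_[p]) : chi p x ≠ 0 := by
  rw [← norm_ne_zero_iff, norm_chi]
  exact one_ne_zero

theorem chi_natCast_mul (n : ℕ) (x : ℚ_[p]) : chi p (n * x) = chi p x ^ n := by
  induction n with
  | zero => simp [chi_zero]
  | succ n ih => rw [Nat.cast_succ, add_mul, one_mul, chi_add, ih, pow_succ]

theorem chi_eq_chi_iff {x y : ℚ_[p]} : chi p x = chi p y ↔ ‖x - y‖ ≤ 1 := by
  rw [← chi_eq_one_iff, ← mul_left_inj' (chi_ne_zero y) (a := chi p (x - y)), ← chi_add,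
    sub_add_cancel, one_mul]

/-! ### Standard representatives -/

theorem sum_range_digits (p k N : ℕ) :
    ∑ i ∈ Finset.range N, (k / p ^ i % p) * p ^ i = k % p ^ N := by
  induction N with
  | zero => simp [Nat.mod_one]
  | succ N ih => rw [Finset.sum_range_succ, ih, Nat.mod_pow_succ, mul_comm (p ^ N)]

theorem sum_range_digits_lt {p : ℕ} {d : ℕ → ℕ} (hd : ∀ i, d i < p) (N : ℕ) :
    ∑ i ∈ Finset.range N, d i * p ^ i < p ^ N := by
  induction N with
  | zero => simp
  | succ N ih =>
    rw [Finset.sum_range_succ, pow_succ]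
    have h1 : (d N + 1) * p ^ N ≤ p * p ^ N := Nat.mul_le_mul_right _ (hd N)
    nlinarith

theorem sum_Ico_digits (d : ℤ → ℕ) (δ : ℤ) (N : ℕ) :
    ∑ l ∈ Finset.Ico (-δ) (-δ + N), (d l : ℚ_[p]) * (p : ℚ_[p]) ^ l =
      ((∑ i ∈ Finset.range N, d (-δ + i) * p ^ i : ℕ) : ℚ_[p]) * (p : ℚ_[p]) ^ (-δ) := by
  have h : Finset.Ico (-δ) (-δ + N) =
      (Finset.range N).image (fun i : ℕ => -δ + (i : ℤ)) := by
    ext l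
    simp only [Finset.mem_Ico, Finset.mem_image, Finset.mem_range]
    constructor
    · rintro ⟨h1, h2⟩
      exact ⟨(l + δ).toNat, by omega, by omega⟩
    · rintro ⟨i, hi, rfl⟩
      omega
  rw [h, Finset.sum_image (fun a _ b _ hab => by simpa using hab), Nat.cast_sum, Finset.sum_mul]
  refine Finset.sum_congr rfl fun i _ => ?_
  rw [zpow_add₀ prime_ne_zero, zpow_natCast]
  push_cast
  ring

theorem mem_reps_of_lt {m : ℤ} {δ : ℤ} {N k : ℕ} (hN : (N : ℤ) = m + δ) (hk : k < p ^ N) :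
    (k : ℚ_[p]) * (p : ℚ_[p]) ^ (-δ) ∈ reps p m := by
  refine ⟨δ, fun l => k / p ^ (l + δ).toNat % p, fun l => Nat.mod_lt _ hp.out.pos, ?_⟩
  rw [show m = -δ + N by omega, sum_Ico_digits]
  have h : ∀ i : ℕ, (-δ + (i : ℤ) + δ).toNat = i := fun i => by omega
  simp only [h]
  rw [sum_range_digits, Nat.mod_eq_of_lt hk]

/-- Allowing every large δ lets two representatives be written over a common denominator, after
which comparing them is a congruence of natural numbers. -/
theorem eq_of_mem_reps {m : ℤ} {x : ℚ_[p]} (hx : x ∈ reps p m) :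
    ∃ M : ℕ, ∀ δ : ℕ, M ≤ δ → ∃ N k : ℕ, (N : ℤ) = m + δ ∧ k < p ^ N ∧
      x = k * (p : ℚ_[p]) ^ (-(δ : ℤ)) := by
  obtain ⟨ε, d, hd, rfl⟩ := hx
  by_cases hε : m ≤ -ε
  · refine ⟨(-m).toNat, fun δ hδ => ⟨(m + δ).toNat, 0, by omega, pow_pos hp.out.pos _, ?_⟩⟩
    rw [Finset.Ico_eq_empty (by omega)]
    simp
  · refine ⟨ε.toNat, fun δ hδ => ⟨(m + δ).toNat,
      (∑ i ∈ Finset.range (m + ε).toNat, d (-ε + i) * p ^ i) * p ^ (δ - ε).toNat,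
      by omega, ?_, ?_⟩⟩
    · rw [show (m + δ).toNat = (m + ε).toNat + (δ - ε).toNat by omega, pow_add]
      exact Nat.mul_lt_mul_of_pos_right (sum_range_digits_lt (fun i => hd _) _)
        (pow_pos hp.out.pos _)
    · rw [show m = -ε + ((m + ε).toNat : ℕ) by omega, sum_Ico_digits]
      rw [show -ε + (((m + ε).toNat : ℕ) : ℤ) + ε = ((m + ε).toNat : ℕ) by omega, Int.toNat_natCast,
        Nat.cast_mul, mul_assoc]
      congr 1
      rw [Nat.cast_pow, ← zpow_natCast, ← zpow_add₀ prime_ne_zero]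
      congr 1
      omega

theorem exists_mem_reps (m : ℤ) (x : ℚ_[p]) : ∃ n ∈ reps p m, ‖x - n‖ ≤ (p : ℝ) ^ (-m) := by
  obtain ⟨δ, hδ, hx⟩ : ∃ δ : ℕ, -m ≤ δ ∧ ‖(p : ℚ_[p]) ^ δ * x‖ ≤ 1 := by
    by_cases hx : x = 0
    · exact ⟨(-m).toNat, by omega, by simp [hx]⟩
    · refine ⟨(-m).toNat + (-x.valuation).toNat, by omega, ?_⟩
      rw [pow_add, mul_assoc, norm_mul, norm_pow]
      exact mul_le_one₀ (pow_le_one₀ (norm_nonneg _) (Padic.norm_p_lt_one).le) (norm_nonneg _)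
        (norm_pow_toNat_mul_le p x)
  obtain ⟨k, hk, h⟩ := exists_natCast_norm_sub_le hx (m + δ).toNat
  refine ⟨k * (p : ℚ_[p]) ^ (-(δ : ℤ)), mem_reps_of_lt (by omega) hk, ?_⟩
  have h1 : x - k * (p : ℚ_[p]) ^ (-(δ : ℤ)) =
      (p : ℚ_[p]) ^ (-(δ : ℤ)) * ((p : ℚ_[p]) ^ δ * x - k) := by
    rw [mul_sub, ← mul_assoc, ← zpow_natCast, ← zpow_add₀ prime_ne_zero]
    simp [mul_comm]
  rw [h1, norm_mul, Padic.norm_p_zpow, neg_neg]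
  calc (p : ℝ) ^ (δ : ℤ) * ‖(p : ℚ_[p]) ^ δ * x - k‖
      ≤ (p : ℝ) ^ (δ : ℤ) * (p : ℝ) ^ (-((m + δ).toNat : ℤ)) := by gcongr
    _ = (p : ℝ) ^ (-m) := by
      rw [← zpow_add₀ prime_pos.ne']
      congr 1
      omega

theorem eq_of_mem_reps_of_norm_sub_le {m : ℤ} {x y : ℚ_[p]} (hx : x ∈ reps p m)
    (hy : y ∈ reps p m) (h : ‖x - y‖ ≤ (p : ℝ) ^ (-m)) : x = y := by
  obtain ⟨M, hM⟩ := eq_of_mem_reps hx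
  obtain ⟨M', hM'⟩ := eq_of_mem_reps hy
  obtain ⟨N, k, hN, hk, rfl⟩ := hM (max M M') (le_max_left _ _)
  obtain ⟨N', l, hN', hl, rfl⟩ := hM' (max M M') (le_max_right _ _)
  obtain rfl : N' = N := by omega
  rw [natCast_eq_of_norm_sub_le hk hl]
  rw [← sub_mul, norm_mul, Padic.norm_p_zpow, neg_neg] at h
  have h2 : (p : ℝ) ^ (-m) =
      (p : ℝ) ^ (-(N' : ℤ)) * (p : ℝ) ^ ((max M M' : ℕ) : ℤ) := by
    rw [← zpow_add₀ prime_pos.ne']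
    congr 1
    omega
  rw [h2] at h
  exact le_of_mul_le_mul_right h (zpow_pos prime_pos _)

/-! ### Haar measure of balls and scaling -/

theorem haar_closedBall_zero_one : haar p (Metric.closedBall 0 1) = 1 :=
  Measure.addHaarMeasure_self (K₀ := unitBall p)

theorem haar_closedBall_eq_zero_center (c : ℚ_[p]) (r : ℝ) :
    haar p (Metric.closedBall c r) = haar p (Metric.closedBall 0 r) := by
  have h := measure_preimage_add (haar p) (-c) (Metric.closedBall 0 r)
  rw [← h]
  congr 1
  ext x
  simp [dist_eq_norm, sub_eq_neg_add]

theorem closedBall_eq_iUnion_closedBall (n : ℤ) :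
    Metric.closedBall (0 : ℚ_[p]) ((p : ℝ) ^ n) =
      ⋃ k ∈ Finset.range p,
        Metric.closedBall ((k : ℚ_[p]) * (p : ℚ_[p]) ^ (-n)) ((p : ℝ) ^ (n - 1)) := by
  have hk : ∀ k : ℕ, ‖(k : ℚ_[p]) * (p : ℚ_[p]) ^ (-n)‖ ≤ (p : ℝ) ^ n := fun k => by
    rw [norm_mul, Padic.norm_p_zpow, neg_neg]
    exact mul_le_of_le_one_left (zpow_nonneg prime_pos.le _) (Padic.norm_int_le_one k)
  ext x
  simp only [Metric.mem_closedBall, dist_eq_norm, sub_zero, Set.mem_iUnion, Finset.mem_range,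
    exists_prop]
  constructor
  · intro hx
    have h1 : ‖x * (p : ℚ_[p]) ^ n‖ ≤ 1 := by
      rw [norm_mul, Padic.norm_p_zpow, zpow_neg]
      exact mul_inv_le_one_of_le₀ hx (zpow_nonneg prime_pos.le _)
    obtain ⟨k, hk, h⟩ := exists_natCast_norm_sub_le h1 1
    refine ⟨k, by simpa using hk, ?_⟩
    have h2 : x - k * (p : ℚ_[p]) ^ (-n) = (x * (p : ℚ_[p]) ^ n - k) * (p : ℚ_[p]) ^ (-n) := by
      rw [sub_mul, mul_assoc, ← zpow_add₀ prime_ne_zero]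
      simp
    rw [h2, norm_mul, Padic.norm_p_zpow, neg_neg, show n - 1 = -((1 : ℕ) : ℤ) + n by omega,
      zpow_add₀ prime_pos.ne']
    exact mul_le_mul_of_nonneg_right h (zpow_nonneg prime_pos.le _)
  · rintro ⟨k, -, h⟩
    have := norm_add_le_of_le (h.trans (zpow_le_zpow_right₀ one_lt_prime.le (by omega))) (hk k)
    simpa using this

theorem pairwiseDisjoint_closedBall (n : ℤ) :
    Set.PairwiseDisjoint (Finset.range p : Set ℕ) (fun k : ℕ =>
      Metric.closedBall ((k : ℚ_[p]) * (p : ℚ_[p]) ^ (-n)) ((p : ℝ) ^ (n - 1))) := by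
  intro k hk l hl hkl
  rw [Function.onFun, Set.disjoint_left]
  intro x hx hx'
  rw [Metric.mem_closedBall, dist_eq_norm] at hx hx'
  refine hkl (natCast_eq_of_norm_sub_le (p := p) (N := 1) (by simpa using hk) (by simpa using hl) ?_)
  have h := norm_sub_le_of_le hx' hx
  rw [show x - l * (p : ℚ_[p]) ^ (-n) - (x - k * (p : ℚ_[p]) ^ (-n)) =
    ((k : ℚ_[p]) - l) * (p : ℚ_[p]) ^ (-n) by ring, norm_mul, Padic.norm_p_zpow, neg_neg,
    show n - 1 = -((1 : ℕ) : ℤ) + n by omega, zpow_add₀ prime_pos.ne'] at h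
  exact le_of_mul_le_mul_right h (zpow_pos prime_pos _)

theorem haar_closedBall_zpow (n : ℤ) :
    haar p (Metric.closedBall 0 ((p : ℝ) ^ n)) =
      p * haar p (Metric.closedBall 0 ((p : ℝ) ^ (n - 1))) := by
  rw [closedBall_eq_iUnion_closedBall, measure_biUnion_finset (pairwiseDisjoint_closedBall n)
    (fun _ _ => measurableSet_closedBall)]
  simp [haar_closedBall_eq_zero_center]

/-- A ball is the disjoint union of p translates of the next smaller one, so volumes scale by p;
induction runs both ways from the unit ball. -/
theorem haar_closedBall (c : ℚ_[p]) (n : ℤ) :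
    haar p (Metric.closedBall c ((p : ℝ) ^ n)) = ENNReal.ofReal ((p : ℝ) ^ n) := by
  have h0 : (p : ENNReal) ≠ 0 := by exact_mod_cast hp.out.ne_zero
  have key : ∀ n : ℤ, ENNReal.ofReal ((p : ℝ) ^ n) = p * ENNReal.ofReal ((p : ℝ) ^ (n - 1)) := by
    intro n
    rw [← ENNReal.ofReal_natCast, ← ENNReal.ofReal_mul prime_pos.le, ← zpow_one_add₀ prime_pos.ne']
    congr 2
    omega
  rw [haar_closedBall_eq_zero_center]
  induction n using Int.induction_on with
  | zero => simp [haar_closedBall_zero_one]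
  | succ n ih => rw [haar_closedBall_zpow, key, add_sub_cancel_right, ih]
  | pred n ih =>
    rw [haar_closedBall_zpow, key] at ih
    exact (ENNReal.mul_right_inj h0 (ENNReal.natCast_ne_top p)).1 ih

theorem haar_closedBall_norm (c : ℚ_[p]) {a : ℚ_[p]} (ha : a ≠ 0) :
    haar p (Metric.closedBall c ‖a‖) = ENNReal.ofReal ‖a‖ := by
  obtain ⟨n, hn⟩ := exists_norm_eq_zpow ha
  rw [hn, haar_closedBall]

/-- Uniqueness of Haar measure gives proportionality; the factor is read off on the unit ball, whose
preimage is the ball of radius |a|. -/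
theorem haar_map_div {a : ℚ_[p]} (ha : a ≠ 0) :
    (haar p).map (fun x => x / a) = ENNReal.ofReal ‖a‖ • haar p := by
  let φ : ℚ_[p] ≃+ ℚ_[p] :=
    { (Homeomorph.mulRight₀ a⁻¹ (inv_ne_zero ha)).toEquiv with
      map_add' := fun x y => add_mul x y _ }
  have hφ : (φ : ℚ_[p] → ℚ_[p]) = fun x : ℚ_[p] => x / a := by
    funext x
    rw [div_eq_mul_inv]
    rfl
  have hm : ((haar p).map (fun x : ℚ_[p] => x / a)).IsAddHaarMeasure := by
    rw [← hφ]
    exact φ.isAddHaarMeasure_map (haar p)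
      (Homeomorph.mulRight₀ a⁻¹ (inv_ne_zero ha)).continuous
      (Homeomorph.mulRight₀ a⁻¹ (inv_ne_zero ha)).symm.continuous
  have h := Measure.isAddLeftInvariant_eq_smul ((haar p).map (fun x : ℚ_[p] => x / a)) (haar p)
  have h1 := congrArg (fun ν => ν (Metric.closedBall 0 1)) h
  have h2 : (fun x : ℚ_[p] => x / a) ⁻¹' Metric.closedBall 0 1 = Metric.closedBall 0 ‖a‖ := by
    ext x
    simp [div_le_one (norm_pos_iff.2 ha)]
  simp only [Measure.smul_apply, haar_closedBall_zero_one] at h1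
  rw [Measure.map_apply (by fun_prop) measurableSet_closedBall, h2, haar_closedBall_norm _ ha] at h1
  rw [ENNReal.smul_def, smul_eq_mul, mul_one] at h1
  rw [h1]
  exact h

theorem integral_comp_affine (F : ℚ_[p] → ℂ) {a : ℚ_[p]} (ha : a ≠ 0) (b : ℚ_[p]) :
    ∫ x, F ((x - b) / a) ∂(haar p) = ‖a‖ * ∫ x, F x ∂(haar p) := by
  rw [integral_sub_right_eq_self (fun x => F (x / a))]
  have h : ∫ x, F (x / a) ∂(haar p) = ∫ y, F y ∂((haar p).map (fun x : ℚ_[p] => x / a)) := by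
    rw [show (fun x : ℚ_[p] => x / a) = (Homeomorph.mulRight₀ a⁻¹ (inv_ne_zero ha)) by
      funext x; simp [div_eq_mul_inv]]
    rw [(Homeomorph.mulRight₀ a⁻¹ (inv_ne_zero ha)).measurableEmbedding.integral_map]
    simp [div_eq_mul_inv]
  rw [h, haar_map_div ha, integral_smul_measure, ENNReal.toReal_ofReal (norm_nonneg _),
    Complex.real_smul]

/-! ### The unitary action on `D₀` inside `L²` -/

/-- The inclusion `D₀(ℚ_p) → L²(ℚ_p)` as a linear map. -/
noncomputable def toL2Linear (p : ℕ) [Fact p.Prime] : D0 p →ₗ[ℂ] L2 p where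
  toFun f := toL2 f.1 f.2
  map_add' f g := MemLp.toLp_add (memLp_of_mem_D0 f.2) (memLp_of_mem_D0 g.2)
  map_smul' c f := MemLp.toLp_const_smul c (memLp_of_mem_D0 f.2)

theorem inner_toL2 {f g : ℚ_[p] → ℂ} (hf : f ∈ D0 p) (hg : g ∈ D0 p) :
    inner ℂ (toL2 f hf) (toL2 g hg) = ∫ x, g x * starRingEnd ℂ (f x) ∂(haar p) := by
  rw [L2.inner_def]
  refine integral_congr_ae ?_
  filter_upwards [(memLp_of_mem_D0 hf).coeFn_toLp, (memLp_of_mem_D0 hg).coeFn_toLp] with x hx hy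
  rw [toL2, toL2, hx, hy]
  rfl

theorem norm_rpow_neg_half_mul_self {a : ℚ_[p]} (ha : a ≠ 0) :
    (‖a‖ ^ (-(1 / 2) : ℝ) * ‖a‖ ^ (-(1 / 2) : ℝ)) * ‖a‖ = 1 := by
  have h := norm_pos_iff.2 ha
  rw [← Real.rpow_add h]
  norm_num
  rw [Real.rpow_neg_one, inv_mul_cancel₀ h.ne']

theorem inner_toL2_smul (h : AffGroup p) {f g : ℚ_[p] → ℂ} (hf : f ∈ D0 p) (hg : g ∈ D0 p) :
    inner ℂ (toL2 (h • f) (smul_mem_D0 h hf)) (toL2 (h • g) (smul_mem_D0 h hg)) =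
      inner ℂ (toL2 f hf) (toL2 g hg) := by
  have ha := h.a_ne_zero
  rw [inner_toL2, inner_toL2]
  have h1 : ∀ x, (h • g) x * starRingEnd ℂ ((h • f) x) =
      ((‖h.a‖ ^ (-(1 / 2) : ℝ) * ‖h.a‖ ^ (-(1 / 2) : ℝ) : ℝ) : ℂ) *
        (fun y => g y * starRingEnd ℂ (f y)) ((x - h.b) / h.a) := fun x => by
    rw [smul_apply, smul_apply, map_mul, Complex.conj_ofReal]
    push_cast
    ring
  simp_rw [h1]
  rw [integral_const_mul, integral_comp_affine (fun y => g y * starRingEnd ℂ (f y)) ha, ← mul_assoc, ← Complex.ofReal_mul,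
    norm_rpow_neg_half_mul_self ha, Complex.ofReal_one, one_mul]

theorem norm_toL2_smul (h : AffGroup p) {f : ℚ_[p] → ℂ} (hf : f ∈ D0 p) :
    ‖toL2 (h • f) (smul_mem_D0 h hf)‖ = ‖toL2 f hf‖ := by
  rw [@norm_eq_sqrt_re_inner ℂ, inner_toL2_smul h hf hf, ← @norm_eq_sqrt_re_inner ℂ]

/-! ### The affine group -/

namespace AffGroup

theorem mul_a (g h : AffGroup p) : (g * h).a = g.a * h.a := rfl

theorem mul_b (g h : AffGroup p) : (g * h).b = g.b + g.a * h.b := rfl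

theorem one_a : (1 : AffGroup p).a = 1 := rfl

theorem one_b : (1 : AffGroup p).b = 0 := rfl

theorem inv_a (g : AffGroup p) : (g⁻¹).a = g.a⁻¹ := rfl

theorem inv_b (g : AffGroup p) : (g⁻¹).b = -g.b * g.a⁻¹ := rfl

theorem conj_a (h s : AffGroup p) : (h⁻¹ * s * h).a = s.a := by
  have := h.a_ne_zero
  rw [mul_a, mul_a, inv_a]
  field_simp

theorem conj_b (h s : AffGroup p) : (h⁻¹ * s * h).b = (s.b + (s.a - 1) * h.b) / h.a := by
  have := h.a_ne_zero
  rw [mul_b, mul_b, mul_a, inv_a, inv_b]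
  field_simp
  ring

theorem smul_finset_sum {ι : Type*} (h : AffGroup p) (s : Finset ι) (C : ι → ℂ)
    (F : ι → ℚ_[p] → ℂ) : h • ∑ i ∈ s, C i • F i = ∑ i ∈ s, C i • h • F i := by
  funext x
  simp only [smul_apply, Finset.sum_apply, Pi.smul_apply, Finset.mul_sum, smul_eq_mul]
  exact Finset.sum_congr rfl fun i _ => by ring

theorem smul_const_smul (h : AffGroup p) (c : ℂ) (F : ℚ_[p] → ℂ) :
    h • (c • F) = c • h • F := by
  funext x
  simp only [smul_apply, Pi.smul_apply, smul_eq_mul]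
  ring

end AffGroup

/-- The subgroup of the affine maps `(a, b)` with `a` in the ball of radius `p^{-A}` around `1`
(and in the open unit ball around `1`) that move the point `c` by at most `p^k`. -/
def affBall (c : ℚ_[p]) (A : ℕ) (k : ℤ) : Subgroup (AffGroup p) where
  -- The strict inequality forces |a| = 1, which is what makes this a group even for A = 0; for A ≥
  -- 1 it follows from the second condition.
  carrier := {g | ‖g.a - 1‖ < 1 ∧ ‖g.a - 1‖ ≤ (p : ℝ) ^ (-(A : ℤ)) ∧
    ‖g.b + (g.a - 1) * c‖ ≤ (p : ℝ) ^ k}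
  one_mem' := by
    refine ⟨?_, ?_, ?_⟩ <;> simp only [AffGroup.one_a, AffGroup.one_b, sub_self, norm_zero,
      zero_mul, add_zero, one_pos]
    all_goals exact zpow_nonneg prime_pos.le _
  mul_mem' := by
    rintro g h ⟨hg1, hg2, hg3⟩ ⟨hh1, hh2, hh3⟩
    have hga := norm_eq_one_of_norm_sub_one_lt hg1
    have e1 : (g * h).a - 1 = g.a * (h.a - 1) + (g.a - 1) := by rw [AffGroup.mul_a]; ring
    have e2 : (g * h).b + ((g * h).a - 1) * c =
        g.a * (h.b + (h.a - 1) * c) + (g.b + (g.a - 1) * c) := by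
      rw [AffGroup.mul_a, AffGroup.mul_b]; ring
    refine ⟨?_, ?_, ?_⟩
    · rw [e1]
      exact (Padic.nonarchimedean _ _).trans_lt (max_lt (by rwa [norm_mul, hga, one_mul]) hg1)
    · rw [e1]
      exact norm_add_le_of_le (by rwa [norm_mul, hga, one_mul]) hg2
    · rw [e2]
      exact norm_add_le_of_le (by rwa [norm_mul, hga, one_mul]) hg3
  inv_mem' := by
    rintro g ⟨hg1, hg2, hg3⟩
    have hga := norm_eq_one_of_norm_sub_one_lt hg1
    have ha := g.a_ne_zero
    have e1 : (g⁻¹).a - 1 = -(g.a - 1) / g.a := by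
      rw [AffGroup.inv_a]; field_simp; ring
    have e2 : (g⁻¹).b + ((g⁻¹).a - 1) * c = -(g.b + (g.a - 1) * c) / g.a := by
      rw [AffGroup.inv_a, AffGroup.inv_b]; field_simp; ring
    refine ⟨?_, ?_, ?_⟩
    · rwa [e1, norm_div, hga, norm_neg, div_one]
    · rwa [e1, norm_div, hga, norm_neg, div_one]
    · rwa [e2, norm_div, hga, norm_neg, div_one]

theorem mem_affBall {c : ℚ_[p]} {A : ℕ} {k : ℤ} {g : AffGroup p} :
    g ∈ affBall c A k ↔ ‖g.a - 1‖ < 1 ∧ ‖g.a - 1‖ ≤ (p : ℝ) ^ (-(A : ℤ)) ∧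
      ‖g.b + (g.a - 1) * c‖ ≤ (p : ℝ) ^ k := Iff.rfl

theorem mem_affBall_iff {c : ℚ_[p]} {A : ℕ} (hA : 1 ≤ A) {k : ℤ} {g : AffGroup p} :
    g ∈ affBall c A k ↔ ‖g.a - 1‖ ≤ (p : ℝ) ^ (-(A : ℤ)) ∧
      ‖g.b + (g.a - 1) * c‖ ≤ (p : ℝ) ^ k := by
  refine ⟨fun h => h.2, fun h => ⟨h.1.trans_lt ?_, h⟩⟩
  exact zpow_lt_one_of_neg₀ one_lt_prime (by omega)

theorem mem_affBall_one_iff {c : ℚ_[p]} {k : ℤ} {g : AffGroup p} :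
    g ∈ affBall c 1 k ↔ ‖g.a - 1‖ < 1 ∧ ‖g.b + (g.a - 1) * c‖ ≤ (p : ℝ) ^ k := by
  refine ⟨fun h => ⟨h.1, h.2.2⟩, fun h => ⟨h.1, ?_, h.2⟩⟩
  simpa using (norm_le_inv_prime_iff _).2 h.1

theorem norm_a_of_mem_affBall {c : ℚ_[p]} {A : ℕ} {k : ℤ} {g : AffGroup p}
    (hg : g ∈ affBall c A k) : ‖g.a‖ = 1 :=
  norm_eq_one_of_norm_sub_one_lt hg.1

/-- Conjugation by h moves the centre c to its image under h, multiplies the radius by |h.a| and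
leaves the linear part alone. -/
theorem conj_mem_affBall {c : ℚ_[p]} {A : ℕ} {k m : ℤ} {h s : AffGroup p}
    (hm : ‖h.a‖ = (p : ℝ) ^ m) :
    h⁻¹ * s * h ∈ affBall c A k ↔ s ∈ affBall (h.b + h.a * c) A (k + m) := by
  have ha := h.a_ne_zero
  have e : (s.b + (s.a - 1) * h.b) / h.a + (s.a - 1) * c =
      (s.b + (s.a - 1) * (h.b + h.a * c)) / h.a := by
    field_simp
    ring
  rw [mem_affBall, mem_affBall, AffGroup.conj_a, AffGroup.conj_b, e, norm_div, hm,
    div_le_iff₀ (zpow_pos prime_pos _), ← zpow_add₀ prime_pos.ne']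

/-! ### The basic wavelet -/

open scoped Classical in
/-- The wavelet `χ(p^{-1} x) Ω(|x|_p)`. -/
noncomputable def psi (p : ℕ) [Fact p.Prime] (x : ℚ_[p]) : ℂ :=
  if ‖x‖ ≤ 1 then chi p ((p : ℚ_[p])⁻¹ * x) else 0

theorem norm_inv_prime_mul_le_one_iff (x : ℚ_[p]) : ‖(p : ℚ_[p])⁻¹ * x‖ ≤ 1 ↔ ‖x‖ < 1 := by
  rw [norm_mul, norm_inv, Padic.norm_p, inv_inv, ← norm_le_inv_prime_iff, mul_comm,
    ← le_div_iff₀ prime_pos, one_div]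

/-- The character by which the stabilizer of the line of the basic wavelet acts. -/
noncomputable def lam (g : AffGroup p) : ℂ := chi p (-((p : ℚ_[p])⁻¹ * g.b))

theorem norm_lam (g : AffGroup p) : ‖lam g‖ = 1 := norm_chi _

theorem lam_eq_lam_iff {g h : AffGroup p} : lam g = lam h ↔ ‖g.b - h.b‖ < 1 := by
  rw [lam, lam, chi_eq_chi_iff, ← norm_inv_prime_mul_le_one_iff, ← norm_neg]
  ring_nf

/-- The defect of multiplicativity is χ of (a-1)b'/p up to sign, which is trivial because |a-1| < 1
and |b'| ≤ 1; off this subgroup the argument breaks down. -/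
theorem lam_mul {g h : AffGroup p} (hg : g ∈ affBall (0 : ℚ_[p]) 1 0)
    (hh : h ∈ affBall (0 : ℚ_[p]) 1 0) : lam (g * h) = lam g * lam h := by
  rw [mem_affBall_one_iff] at hg hh
  rw [lam, lam, lam, ← chi_add, chi_eq_chi_iff, AffGroup.mul_b, show
    -((p : ℚ_[p])⁻¹ * (g.b + g.a * h.b)) - (-((p : ℚ_[p])⁻¹ * g.b) + -((p : ℚ_[p])⁻¹ * h.b)) =
      (p : ℚ_[p])⁻¹ * (-((g.a - 1) * h.b)) by ring, norm_inv_prime_mul_le_one_iff, norm_neg,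
    norm_mul]
  exact mul_lt_one_of_nonneg_of_lt_one_left (norm_nonneg _) hg.1 (by simpa using hh.2)

theorem smul_psi {g : AffGroup p} (hg : g ∈ affBall (0 : ℚ_[p]) 1 0) :
    g • psi p = lam g • psi p := by
  rw [mem_affBall_one_iff, mul_zero, add_zero, zpow_zero] at hg
  have ha := norm_eq_one_of_norm_sub_one_lt hg.1
  have ha0 := g.a_ne_zero
  funext x
  rw [smul_apply, ha, Real.one_rpow, Complex.ofReal_one, one_mul, Pi.smul_apply, psi, psi,
    norm_div, ha, div_one]
  have hiff : ‖x - g.b‖ ≤ 1 ↔ ‖x‖ ≤ 1 :=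
    ⟨fun h => by simpa using norm_add_le_of_le h hg.2, fun h => norm_sub_le_of_le h hg.2⟩
  by_cases hx : ‖x‖ ≤ 1
  · rw [if_pos hx, if_pos (hiff.2 hx), smul_eq_mul, lam, ← chi_add, chi_eq_chi_iff, show
      (p : ℚ_[p])⁻¹ * ((x - g.b) / g.a) - (-((p : ℚ_[p])⁻¹ * g.b) + (p : ℚ_[p])⁻¹ * x) =
        (p : ℚ_[p])⁻¹ * (-((g.a - 1) * (x - g.b)) / g.a) by field_simp; ring,
      norm_inv_prime_mul_le_one_iff, norm_div, norm_neg, norm_mul, ha, div_one]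
    exact mul_lt_one_of_nonneg_of_lt_one_left (norm_nonneg _) hg.1 (hiff.2 hx)
  · rw [if_neg hx, if_neg (fun h => hx (hiff.1 h)), smul_zero]

theorem isLocallyConstant_psi : IsLocallyConstant (psi p) := by
  rw [IsLocallyConstant.iff_eventually_eq]
  intro x
  filter_upwards [Metric.ball_mem_nhds x one_pos] with y hy
  rw [Metric.mem_ball, dist_eq_norm] at hy
  have hiff : ‖y‖ ≤ 1 ↔ ‖x‖ ≤ 1 := by
    constructor <;> intro h
    · have := norm_sub_le_of_le h hy.le
      simpa using this
    · have := norm_add_le_of_le hy.le h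
      simpa using this
  simp only [psi, hiff]
  congr 1
  rw [chi_eq_chi_iff, ← mul_sub, norm_inv_prime_mul_le_one_iff]
  exact hy

theorem hasCompactSupport_psi : HasCompactSupport (psi p) := by
  refine HasCompactSupport.intro (isCompact_closedBall (0 : ℚ_[p]) 1) fun x hx => ?_
  rw [Metric.mem_closedBall, dist_zero_right] at hx
  exact if_neg hx

/-- The translation by `b`. -/
noncomputable def translation (b : ℚ_[p]) : AffGroup p := ⟨1, b, one_ne_zero⟩

theorem translation_mem {b : ℚ_[p]} (hb : ‖b‖ ≤ 1) :
    translation b ∈ affBall (0 : ℚ_[p]) 1 0 := by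
  rw [mem_affBall_one_iff]
  simpa [translation] using hb

theorem psi_mem_D0 : psi p ∈ D0 p := by
  refine ⟨isLocallyConstant_psi, hasCompactSupport_psi, ?_⟩
  -- Mean zero: translation by 1 preserves the integral but multiplies ψ by a nontrivial phase.
  have h1 := smul_psi (translation_mem (p := p) (b := 1) (by simp))
  have h2 : ∀ x, psi p (x - 1) = lam (translation (1 : ℚ_[p])) * psi p x := fun x => by
    have := congrFun h1 x
    simpa [smul_apply, translation] using this
  have h3 := integral_sub_right_eq_self (μ := haar p) (psi p) 1
  simp_rw [h2] at h3
  rw [integral_const_mul] at h3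
  have h4 : lam (translation (1 : ℚ_[p])) ≠ 1 := by
    rw [lam, Ne, chi_eq_one_iff, norm_neg, norm_inv_prime_mul_le_one_iff]
    simp [translation]
  by_contra h0
  exact h4 (mul_right_cancel₀ h0 (by rw [h3, one_mul]))

/-- The element `G(g)ψ` of `L²(ℚ_p)`. -/
noncomputable def coherent (g : AffGroup p) : L2 p := toL2 (g • psi p) (smul_mem_D0 g psi_mem_D0)

theorem norm_toL2_psi : ‖toL2 (psi p) psi_mem_D0‖ = 1 := by
  rw [@norm_eq_sqrt_re_inner ℂ, inner_toL2]
  have h : ∀ x, psi p x * starRingEnd ℂ (psi p x) =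
      (Metric.closedBall (0 : ℚ_[p]) 1).indicator (fun _ => (1 : ℂ)) x := fun x => by
    by_cases hx : ‖x‖ ≤ 1
    · rw [Set.indicator_of_mem (by simpa using hx), psi, if_pos hx, Complex.mul_conj,
        Complex.normSq_eq_norm_sq, norm_chi]
      simp
    · rw [Set.indicator_of_notMem (by simpa using hx), psi, if_neg hx, zero_mul]
  simp_rw [h]
  rw [integral_indicator measurableSet_closedBall]
  simp [Measure.real, haar_closedBall_zero_one]

theorem norm_coherent (g : AffGroup p) : ‖coherent g‖ = 1 := by
  rw [coherent, norm_toL2_smul g psi_mem_D0, norm_toL2_psi]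

theorem toL2_congr {f g : ℚ_[p] → ℂ} (h : f = g) (hf : f ∈ D0 p) (hg : g ∈ D0 p) :
    toL2 f hf = toL2 g hg := by
  subst h
  rfl

theorem inner_coherent_mul (g h k : AffGroup p) :
    inner ℂ (coherent (g * h)) (coherent (g * k)) = inner ℂ (coherent h) (coherent k) := by
  rw [coherent, coherent, toL2_congr (mul_smul g h (psi p)) _ (smul_mem_D0 _ (smul_mem_D0 _
    psi_mem_D0)), toL2_congr (mul_smul g k (psi p)) _ (smul_mem_D0 _ (smul_mem_D0 _ psi_mem_D0))]
  exact inner_toL2_smul g _ _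

theorem coherent_mul (g : AffGroup p) {l : AffGroup p} (hl : l ∈ affBall (0 : ℚ_[p]) 1 0) :
    coherent (g * l) = lam l • coherent g := by
  rw [coherent, toL2_congr (g := lam l • g • psi p) (by
    rw [mul_smul, smul_psi hl, AffGroup.smul_const_smul]) _
    ((D0 p).smul_mem _ (smul_mem_D0 _ psi_mem_D0))]
  exact (toL2Linear p).map_smul (lam l) ⟨g • psi p, smul_mem_D0 _ psi_mem_D0⟩

/-- Outside of the stabilizer of the line of the basic wavelet, the character `lam` and its
conjugate disagree somewhere. -/
theorem exists_lam_ne_lam_conj {h : AffGroup p} (hh : h ∉ affBall (0 : ℚ_[p]) 1 0) :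
    ∃ s ∈ affBall (0 : ℚ_[p]) 1 0, h⁻¹ * s * h ∈ affBall (0 : ℚ_[p]) 1 0 ∧
      lam s ≠ lam (h⁻¹ * s * h) := by
  have ha := h.a_ne_zero
  -- First attempt: s a translation by b. Its conjugate is the translation by b / h.a, and the
  -- phases differ as soon as |b - b / h.a| ≥ 1.
  have key : ∀ b : ℚ_[p], ‖b‖ ≤ 1 → ‖b / h.a‖ ≤ 1 → 1 ≤ ‖b - b / h.a‖ →
      ∃ s ∈ affBall (0 : ℚ_[p]) 1 0, h⁻¹ * s * h ∈ affBall (0 : ℚ_[p]) 1 0 ∧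
        lam s ≠ lam (h⁻¹ * s * h) := by
    intro b h1 h2 h3
    refine ⟨translation b, translation_mem h1, ?_, ?_⟩
    · rw [mem_affBall_one_iff, AffGroup.conj_a, AffGroup.conj_b]
      simpa [translation] using h2
    · rw [Ne, lam_eq_lam_iff, AffGroup.conj_b, not_lt]
      simpa [translation] using h3
  rcases lt_trichotomy ‖h.a‖ 1 with h1 | h1 | h1
  · refine key h.a h1.le (by rw [div_self ha, norm_one]) ?_
    rw [div_self ha]
    refine not_lt.1 fun h2 => ?_
    exact h1.ne (norm_eq_one_of_norm_sub_one_lt h2)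
  · by_cases h2 : ‖h.a - 1‖ < 1
    -- Here h.a ≡ 1, so translations cannot separate the characters, but h.b is large. The dilation
    -- by 1 + h.a / h.b has λ = 1, and the factor is chosen so that its conjugate has translation
    -- part exactly 1.
    · have h3 : 1 < ‖h.b‖ := by
        rw [mem_affBall_one_iff] at hh
        push Not at hh
        simpa using hh h2
      have hb : h.b ≠ 0 := norm_pos_iff.1 (one_pos.trans h3)
      have h4 : ‖h.a / h.b‖ < 1 := by
        rw [norm_div, h1, one_div]
        exact inv_lt_one_of_one_lt₀ h3
      have h5 : ‖1 + h.a / h.b‖ = 1 := norm_eq_one_of_norm_sub_one_lt (by simpa using h4)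
      have h6 : (0 + (1 + h.a / h.b - 1) * h.b) / h.a = 1 := by field_simp; ring
      refine ⟨⟨1 + h.a / h.b, 0, norm_pos_iff.1 (h5 ▸ one_pos)⟩, ?_, ?_, ?_⟩
      · rw [mem_affBall_one_iff]
        simpa using h4
      · rw [mem_affBall_one_iff, AffGroup.conj_a, AffGroup.conj_b, h6]
        simpa using h4
      · rw [Ne, lam_eq_lam_iff, AffGroup.conj_b, h6]
        simp
    -- The witness solves b - b / h.a = 1.
    · have h3 : ‖h.a - 1‖ = 1 :=
        le_antisymm (norm_sub_le_of_le h1.le (by simp)) (not_lt.1 h2)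
      have h4 : h.a - 1 ≠ 0 := norm_pos_iff.1 (h3 ▸ one_pos)
      refine key (h.a / (h.a - 1)) (by simp [h1, h3]) (by simp [h1, h3]) ?_
      rw [show h.a / (h.a - 1) - h.a / (h.a - 1) / h.a = 1 by field_simp]
      simp
  · have h2 : ‖1 / h.a‖ < 1 := by
      rw [norm_div, norm_one, one_div]
      exact inv_lt_one_of_one_lt₀ h1
    refine key 1 (by simp) h2.le (not_lt.1 fun h3 => ?_)
    rw [norm_sub_rev] at h3
    exact h2.ne (norm_eq_one_of_norm_sub_one_lt h3)

/-- Applying s to both vectors multiplies the inner product by the conjugate of λ(s) times λ(h⁻¹sh),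
which is not 1 for a suitable s; eigenvectors with distinct unitary eigenvalues are orthogonal. -/
theorem inner_coherent_one_eq_zero {h : AffGroup p} (hh : h ∉ affBall (0 : ℚ_[p]) 1 0) :
    inner ℂ (coherent 1) (coherent h) = 0 := by
  obtain ⟨s, hs, hs', hne⟩ := exists_lam_ne_lam_conj hh
  have h1 := inner_coherent_mul s 1 h
  rw [mul_one, show s * h = h * (h⁻¹ * s * h) by group, coherent_mul h hs',
    show s = 1 * s by group, coherent_mul 1 hs, one_mul, inner_smul_left, inner_smul_right] at h1
  by_contra h0
  have h2 : starRingEnd ℂ (lam s) * lam (h⁻¹ * s * h) = 1 :=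
    mul_right_cancel₀ h0 (by rw [mul_assoc, h1, one_mul])
  have h3 : lam s * starRingEnd ℂ (lam s) = 1 := by
    rw [Complex.mul_conj, Complex.normSq_eq_norm_sq, norm_lam]
    simp
  refine hne ?_
  calc lam s = lam s * (starRingEnd ℂ (lam s) * lam (h⁻¹ * s * h)) := by rw [h2, mul_one]
    _ = lam (h⁻¹ * s * h) := by rw [← mul_assoc, h3, one_mul]

theorem inner_coherent_eq_zero {g h : AffGroup p} (hh : g⁻¹ * h ∉ affBall (0 : ℚ_[p]) 1 0) :
    inner ℂ (coherent g) (coherent h) = 0 := by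
  have := inner_coherent_mul g 1 (g⁻¹ * h)
  rw [mul_one, mul_inv_cancel_left] at this
  rw [this, inner_coherent_one_eq_zero hh]

/-- An element fixing ψ must lie in K, since otherwise the unit vector ψ would be orthogonal to
itself; inside K only the condition λ = 1 remains. -/
theorem stabilizer_psi :
    MulAction.stabilizer (AffGroup p) (psi p) = affBall (0 : ℚ_[p]) 1 (-1) := by
  have h1 : ∀ g : AffGroup p, g ∈ affBall (0 : ℚ_[p]) 1 0 → (g • psi p = psi p ↔ ‖g.b‖ < 1) := by
    intro g hg
    rw [smul_psi hg, ← norm_inv_prime_mul_le_one_iff, ← norm_neg, ← chi_eq_one_iff]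
    constructor
    · intro h
      have h2 : lam g = 1 := by simpa [psi, chi_zero] using congrFun h 0
      exact h2
    · intro h
      rw [lam, h, one_smul]
  ext g
  rw [MulAction.mem_stabilizer_iff]
  constructor
  · intro hg
    have hg' : g ∈ affBall (0 : ℚ_[p]) 1 0 := by
      by_contra hc
      have h2 := inner_coherent_one_eq_zero hc
      have h3 : coherent g = coherent 1 := toL2_congr (by rw [hg, one_smul]) _ _
      rw [h3, inner_self_eq_norm_sq_to_K, norm_coherent] at h2
      simp at h2
    have h2 := (h1 g hg').1 hg
    rw [mem_affBall_one_iff] at hg' ⊢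
    exact ⟨hg'.1, by simpa using (norm_le_inv_prime_iff _).2 h2⟩
  · intro hg
    rw [mem_affBall_one_iff] at hg
    have h2 : ‖g.b‖ < 1 := (norm_le_inv_prime_iff _).1 (by simpa using hg.2)
    exact (h1 g (by rw [mem_affBall_one_iff]; exact ⟨hg.1, by simpa using h2.le⟩)).2 h2

/-! ### Completeness of the coherent states -/

theorem haar_closedBall_ne_top (c : ℚ_[p]) (r : ℝ) : haar p (Metric.closedBall c r) ≠ ⊤ :=
  (isCompact_closedBall c r).measure_lt_top.ne

/-- The indicator function of a ball as an element of `L²(ℚ_p)`. -/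
noncomputable def ballL2 (c : ℚ_[p]) (r : ℝ) : L2 p :=
  indicatorConstLp 2 (measurableSet_closedBall : MeasurableSet (Metric.closedBall c r))
    (haar_closedBall_ne_top c r) (1 : ℂ)

theorem inner_ballL2 (c : ℚ_[p]) (r : ℝ) (g : L2 p) :
    inner ℂ (ballL2 c r) g = ∫ x in Metric.closedBall c r, g x ∂(haar p) :=
  L2.inner_indicatorConstLp_one _ _ g

theorem norm_ballL2_sq (c : ℚ_[p]) (n : ℤ) : ‖ballL2 c ((p : ℝ) ^ n)‖ ^ 2 = (p : ℝ) ^ n := by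
  rw [ballL2, norm_indicatorConstLp (by norm_num) (by norm_num), norm_one, one_mul,
    ← Real.rpow_natCast, ← Real.rpow_mul measureReal_nonneg, Measure.real, haar_closedBall,
    ENNReal.toReal_ofReal (zpow_nonneg prime_pos.le _)]
  norm_num

open scoped Classical in
-- With ζ = χ(x/p) this is a geometric sum without its zeroth term: ζ = 1 when |x| < 1, and ζ is a
-- nontrivial p-th root of unity when |x| = 1.
theorem sum_psi_natCast_mul (x : ℚ_[p]) :
    ∑ j ∈ Finset.Icc 1 (p - 1), psi p (j * x) =
      p * (if ‖x‖ < 1 then 1 else 0) - if ‖x‖ ≤ 1 then 1 else 0 := by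
  have hlt : ∀ j ∈ Finset.Icc 1 (p - 1), ‖(j : ℚ_[p])‖ = 1 := fun j hj => by
    rw [Finset.mem_Icc] at hj
    rw [Padic.norm_natCast_eq_one_iff, hp.out.coprime_iff_not_dvd]
    exact Nat.not_dvd_of_pos_of_lt (by omega) (by omega)
  have h1 : ∀ j ∈ Finset.Icc 1 (p - 1), psi p (j * x) =
      if ‖x‖ ≤ 1 then chi p ((p : ℚ_[p])⁻¹ * x) ^ j else 0 := fun j hj => by
    rw [psi, norm_mul, hlt j hj, one_mul, ← chi_natCast_mul, mul_left_comm]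
  rw [Finset.sum_congr rfl h1]
  have h2 : ∀ ζ : ℂ, ∑ j ∈ Finset.Icc 1 (p - 1), ζ ^ j = ∑ j ∈ Finset.range p, ζ ^ j - 1 := by
    intro ζ
    have h3 : Finset.range p = insert 0 (Finset.Icc 1 (p - 1)) := by
      ext j
      have := hp.out.pos
      simp only [Finset.mem_range, Finset.mem_insert, Finset.mem_Icc]
      omega
    rw [h3, Finset.sum_insert (by simp)]
    simp
  by_cases hx : ‖x‖ < 1
  · have h3 := chi_eq_one_iff.2 ((norm_inv_prime_mul_le_one_iff x).2 hx)
    simp [hx, hx.le, h3, Nat.cast_sub hp.out.one_lt.le]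
  · by_cases hx' : ‖x‖ ≤ 1
    · have h3 : chi p ((p : ℚ_[p])⁻¹ * x) ≠ 1 := fun h =>
        hx ((norm_inv_prime_mul_le_one_iff x).1 (chi_eq_one_iff.1 h))
      have h4 : chi p ((p : ℚ_[p])⁻¹ * x) ^ p = 1 := by
        rw [← chi_natCast_mul, mul_inv_cancel_left₀ prime_ne_zero]
        exact chi_eq_one_iff.2 hx'
      simp only [hx, hx', if_true, if_false, h2]
      rw [geom_sum_eq h3, h4]
      simp
    · simp [hx, hx']

/-- The sum over j of the coherent states adapted to the ball is a nonzero multiple of p·1_small -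
1_big, so a vector orthogonal to all coherent states has integrals over concentric balls growing by
the factor p. -/
theorem inner_ballL2_eq_of_orthogonal {g : L2 p} (hg : ∀ h, inner ℂ (coherent h) g = 0)
    (c : ℚ_[p]) (n : ℤ) :
    inner ℂ (ballL2 c ((p : ℝ) ^ n)) g = p * inner ℂ (ballL2 c ((p : ℝ) ^ (n - 1))) g := by
  classical
  let t : ℚ_[p] := (p : ℚ_[p]) ^ (-n)
  have ht : t ≠ 0 := zpow_ne_zero _ prime_ne_zero
  have htn : ‖t‖ = (p : ℝ) ^ n := by rw [Padic.norm_p_zpow, neg_neg]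
  let r : ℂ := ((‖t‖ ^ (-(1 / 2) : ℝ) : ℝ) : ℂ)
  have hr : r ≠ 0 := by
    have := Real.rpow_pos_of_pos (norm_pos_iff.2 ht) (-(1 / 2))
    exact Complex.ofReal_ne_zero.2 this.ne'
  -- The value 1 at j = 0 only makes `e` total; the sums run over 1 ≤ j ≤ p - 1.
  let e : ℕ → AffGroup p := fun j => if hj : (j : ℚ_[p]) = 0 then 1 else ⟨t / j, c, div_ne_zero ht hj⟩
  have he : ∀ j ∈ Finset.Icc 1 (p - 1), ∀ x, (e j • psi p) x = r * psi p (j * ((x - c) / t)) := by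
    intro j hj x
    rw [Finset.mem_Icc] at hj
    have hj0 : (j : ℚ_[p]) ≠ 0 := by exact_mod_cast (by omega : j ≠ 0)
    have hj1 : ‖(j : ℚ_[p])‖ = 1 := by
      rw [Padic.norm_natCast_eq_one_iff, hp.out.coprime_iff_not_dvd]
      exact Nat.not_dvd_of_pos_of_lt (by omega) (by omega)
    rw [smul_apply]
    simp only [e, dif_neg hj0, norm_div, hj1, div_one]
    congr 2
    field_simp
  have hsum : ∑ j ∈ Finset.Icc 1 (p - 1), coherent (e j) =
      r • ((p : ℂ) • ballL2 c ((p : ℝ) ^ (n - 1)) - ballL2 c ((p : ℝ) ^ n)) := by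
    have h1 : ∑ j ∈ Finset.Icc 1 (p - 1), coherent (e j) =
        toL2Linear p (∑ j ∈ Finset.Icc 1 (p - 1), ⟨e j • psi p, smul_mem_D0 _ psi_mem_D0⟩) := by
      rw [map_sum]
      rfl
    rw [h1]
    change toL2 _ (SetLike.coe_mem _) = _
    rw [toL2, ballL2, ballL2, indicatorConstLp, indicatorConstLp, ← MemLp.toLp_const_smul,
      ← MemLp.toLp_sub, ← MemLp.toLp_const_smul]
    refine MemLp.toLp_congr _ _ (Filter.Eventually.of_forall fun x => ?_)
    have h2 : ‖(x - c) / t‖ ≤ 1 ↔ x ∈ Metric.closedBall c ((p : ℝ) ^ n) := by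
      rw [norm_div, htn, div_le_one (zpow_pos prime_pos _), Metric.mem_closedBall, dist_eq_norm]
    have h3 : ‖(x - c) / t‖ < 1 ↔ x ∈ Metric.closedBall c ((p : ℝ) ^ (n - 1)) := by
      rw [norm_div, htn, div_lt_one (zpow_pos prime_pos _), Metric.mem_closedBall, dist_eq_norm,
        Padic.norm_lt_pow_iff_norm_le_pow_sub_one]
    simp only [AddSubmonoidClass.coe_finsetSum, Finset.sum_apply, Pi.smul_apply, Pi.sub_apply,
      Set.indicator_apply, smul_eq_mul]
    rw [Finset.sum_congr rfl fun j hj => he j hj x, ← Finset.mul_sum, sum_psi_natCast_mul]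
    simp only [h2, h3]
  have h0 : inner ℂ (∑ j ∈ Finset.Icc 1 (p - 1), coherent (e j)) g = 0 := by
    rw [sum_inner]
    exact Finset.sum_eq_zero fun j _ => hg _
  rw [hsum, inner_smul_left, inner_sub_left, inner_smul_left, mul_eq_zero] at h0
  rcases h0 with h0 | h0
  · exact absurd ((map_eq_zero _).1 h0) hr
  · rw [sub_eq_zero] at h0
    simpa using h0.symm

/-- Enlarging the radius by p^k multiplies the inner product by p^k, while Cauchy-Schwarz allows
growth only by p^(k/2). -/
theorem inner_ballL2_eq_zero_of_orthogonal {g : L2 p} (hg : ∀ h, inner ℂ (coherent h) g = 0)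
    (c : ℚ_[p]) (n : ℤ) : inner ℂ (ballL2 c ((p : ℝ) ^ n)) g = 0 := by
  have h1 : ∀ k : ℕ, inner ℂ (ballL2 c ((p : ℝ) ^ (n + k))) g =
      (p : ℂ) ^ k * inner ℂ (ballL2 c ((p : ℝ) ^ n)) g := by
    intro k
    induction k with
    | zero => simp
    | succ k ih =>
      rw [inner_ballL2_eq_of_orthogonal hg, show n + ((k + 1 : ℕ) : ℤ) - 1 = n + k by push_cast; ring,
        ih, pow_succ']
      ring
  by_contra h0
  have h2 : ∀ k : ℕ, ‖(inner ℂ (ballL2 c ((p : ℝ) ^ n)) g : ℂ)‖ ^ 2 * (p : ℝ) ^ k ≤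
      (p : ℝ) ^ n * ‖g‖ ^ 2 := by
    intro k
    have h3 := norm_inner_le_norm (𝕜 := ℂ) (ballL2 c ((p : ℝ) ^ (n + k))) g
    rw [h1, norm_mul, norm_pow, Complex.norm_natCast] at h3
    have h4 := pow_le_pow_left₀ (by positivity) h3 2
    rw [mul_pow, mul_pow, norm_ballL2_sq, zpow_add₀ prime_pos.ne', zpow_natCast] at h4
    have h5 : (0 : ℝ) < (p : ℝ) ^ k := pow_pos prime_pos k
    refine le_of_mul_le_mul_right ?_ h5
    calc _ = ((p : ℝ) ^ k) ^ 2 * ‖(inner ℂ (ballL2 c ((p : ℝ) ^ n)) g : ℂ)‖ ^ 2 := by ring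
      _ ≤ _ := h4
      _ = _ := by ring
  have h3 : 0 < ‖(inner ℂ (ballL2 c ((p : ℝ) ^ n)) g : ℂ)‖ ^ 2 := by positivity
  obtain ⟨k, hk⟩ := pow_unbounded_of_one_lt
    ((p : ℝ) ^ n * ‖g‖ ^ 2 / ‖(inner ℂ (ballL2 c ((p : ℝ) ^ n)) g : ℂ)‖ ^ 2)
    (one_lt_prime (p := p))
  rw [div_lt_iff₀ h3] at hk
  exact absurd (h2 k) (not_le.2 (hk.trans_eq (mul_comm _ _)))

/-- The set of balls of radius an integral power of `p`. -/
def ballSets (p : ℕ) [Fact p.Prime] : Set (Set ℚ_[p]) :=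
  {s | ∃ (c : ℚ_[p]) (n : ℤ), s = Metric.closedBall c ((p : ℝ) ^ n)}

theorem isPiSystem_ballSets : IsPiSystem (ballSets p) := by
  rintro _ ⟨c, n, rfl⟩ _ ⟨d, m, rfl⟩ hne
  rcases IsUltrametricDist.closedBall_subset_trichotomy c d ((p : ℝ) ^ n) ((p : ℝ) ^ m) with h | h | h
  · rw [Set.inter_eq_left.2 h]
    exact ⟨c, n, rfl⟩
  · rw [Set.inter_eq_right.2 h]
    exact ⟨d, m, rfl⟩
  · exact absurd h (Set.not_disjoint_iff_nonempty_inter.2 hne)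

theorem generateFrom_ballSets :
    instMeasurableSpacePadic p = MeasurableSpace.generateFrom (ballSets p) := by
  refine TopologicalSpace.IsTopologicalBasis.borel_eq_generateFrom
    (TopologicalSpace.isTopologicalBasis_of_isOpen_of_nhds ?_ ?_)
  · rintro _ ⟨c, n, rfl⟩
    exact IsUltrametricDist.isOpen_closedBall c (zpow_pos prime_pos n).ne'
  · intro a u ha hu
    obtain ⟨ε, hε, h⟩ := Metric.isOpen_iff.1 hu a ha
    obtain ⟨k, hk⟩ := PadicInt.exists_pow_neg_lt p hε
    exact ⟨_, ⟨a, -k, rfl⟩, Metric.mem_closedBall_self (zpow_nonneg prime_pos.le _),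
      (Metric.closedBall_subset_ball hk).trans h⟩

/-- Two balls are nested or disjoint, so balls form a π-system; it generates the Borel sets, and
Dynkin's argument passes from balls to all Borel sets. -/
theorem eq_zero_of_setIntegral_closedBall {g : L2 p}
    (hg : ∀ (c : ℚ_[p]) (n : ℤ), ∫ x in Metric.closedBall c ((p : ℝ) ^ n), g x ∂(haar p) = 0) :
    g = 0 := by
  have hloc : LocallyIntegrable g (haar p) := (Lp.memLp g).locallyIntegrable (by norm_num)
  -- An L² function is only locally integrable here, so the induction takes place inside a fixed
  -- large ball.
  have key : ∀ (M : ℤ) (s : Set ℚ_[p]), MeasurableSet s →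
      ∫ x in s ∩ Metric.closedBall 0 ((p : ℝ) ^ M), g x ∂(haar p) = 0 := by
    intro M s hs
    have hint : IntegrableOn g (Metric.closedBall 0 ((p : ℝ) ^ M)) (haar p) :=
      hloc.integrableOn_isCompact (isCompact_closedBall _ _)
    induction s, hs using MeasurableSpace.induction_on_inter generateFrom_ballSets
      isPiSystem_ballSets with
    | empty => simp
    | basic t ht =>
      by_cases hne : (t ∩ Metric.closedBall 0 ((p : ℝ) ^ M)).Nonempty
      · obtain ⟨c, n, h⟩ := isPiSystem_ballSets t ht _ ⟨0, M, rfl⟩ hne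
        rw [h, hg]
      · rw [Set.not_nonempty_iff_eq_empty.1 hne]
        simp
    | compl t ht ih =>
      have h1 := integral_inter_add_sdiff ht hint
      rw [hg, Set.inter_comm, ih, zero_add] at h1
      rwa [Set.inter_comm, ← Set.sdiff_eq]
    | iUnion f hd hf ih =>
      rw [Set.iUnion_inter, integral_iUnion (fun i => (hf i).inter measurableSet_closedBall)
        (fun i j hij => (hd hij).mono Set.inter_subset_left Set.inter_subset_left)
        (hint.mono_set (Set.iUnion_subset fun i => Set.inter_subset_right))]
      simp [ih]
  rw [Lp.eq_zero_iff_ae_eq_zero]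
  refine ae_eq_zero_of_forall_setIntegral_isCompact_eq_zero' hloc fun s hs => ?_
  obtain ⟨r, hr⟩ := hs.isBounded.subset_closedBall 0
  obtain ⟨k, hk⟩ := pow_unbounded_of_one_lt r (one_lt_prime (p := p))
  have h1 : s ⊆ Metric.closedBall 0 ((p : ℝ) ^ (k : ℤ)) :=
    hr.trans (Metric.closedBall_subset_closedBall (by rw [zpow_natCast]; exact hk.le))
  rw [← key k s hs.measurableSet, Set.inter_eq_left.2 h1]

theorem eq_zero_of_orthogonal_coherent {g : L2 p} (hg : ∀ h, inner ℂ (coherent h) g = 0) :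
    g = 0 :=
  eq_zero_of_setIntegral_closedBall fun c n => by
    rw [← inner_ballL2, inner_ballL2_eq_zero_of_orthogonal hg]

/-! ### Sums over coset spaces -/

section Cosets

variable {G : Type*} [Group G]

/-- In G/S ≃ G/L × L/S the function is constant along the finite second factor. -/
theorem hasSum_quotient_of_le {S L : Subgroup G} (hSL : S ≤ L) (hfin : S.relIndex L ≠ 0)
    {F : G → ℝ} (hF0 : ∀ g, 0 ≤ F g) (hF : ∀ g, ∀ l ∈ L, F (g * l) = F g) {A : ℝ}
    (hA : HasSum (fun q : G ⧸ L => F q.out) A) :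
    HasSum (fun q : G ⧸ S => F q.out) (S.relIndex L * A) := by
  have hfin' : Finite (L ⧸ S.subgroupOf L) := (Nat.card_ne_zero.1 hfin).2
  have := Fintype.ofFinite (L ⧸ S.subgroupOf L)
  have h1 : HasSum (fun _ : L ⧸ S.subgroupOf L => (1 : ℝ)) (S.relIndex L) := by
    convert hasSum_fintype (fun _ : L ⧸ S.subgroupOf L => (1 : ℝ))
    rw [Finset.sum_const, nsmul_one, Finset.card_univ, ← Nat.card_eq_fintype_card]
    rfl
  have h2 := hA.mul h1
    (hA.summable.mul_of_nonneg h1.summable (fun _ => hF0 _) fun _ => zero_le_one)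
  rw [mul_comm, ← (Subgroup.quotientEquivProdOfLE hSL).hasSum_iff] at h2
  refine Eq.subst (motive := fun f => HasSum f (S.relIndex L * A)) (funext fun q => ?_) h2
  symm
  obtain ⟨g, rfl⟩ := QuotientGroup.mk_surjective q
  obtain ⟨s, hs⟩ := QuotientGroup.mk_out_eq_mul S g
  have h3 : (Subgroup.quotientEquivProdOfLE hSL (g : G ⧸ S)).1 = (g : G ⧸ L) := rfl
  obtain ⟨l, hl⟩ := QuotientGroup.mk_out_eq_mul L g
  rw [Function.comp_apply, h3, hs, hl, mul_one, hF _ _ (hSL s.2), hF _ _ l.2]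

/-- Split G/S as G/M × M/S. Along each fibre the sum is a multiple of the sum of a nontrivial
character over M/S, which vanishes. -/
theorem hasSum_quotient_zero {S M : Subgroup G} (hSM : S ≤ M) {v μ : G → ℂ}
    (hv : ∀ g, ∀ m ∈ M, v (g * m) = μ m * v g)
    (hμ : ∀ m ∈ M, ∀ n ∈ M, μ (m * n) = μ m * μ n) (hS : ∀ s ∈ S, μ s = 1)
    {m₀ : G} (hm₀ : m₀ ∈ M) (hne : μ m₀ ≠ 1) (hsum : Summable fun q : G ⧸ S => v q.out) :
    HasSum (fun q : G ⧸ S => v q.out) 0 := by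
  let e := Subgroup.quotientEquivProdOfLE hSM
  have h1 : ∀ x, v (e.symm x).out = v x.1.out * μ (x.2.out : M) := by
    rintro ⟨a, r⟩
    have h2 : e.symm (a, r) = ((a.out * (r.out : M) : G) : G ⧸ S) := by
      conv_lhs => rw [← QuotientGroup.out_eq' r]
      rfl
    obtain ⟨s, hs⟩ := QuotientGroup.mk_out_eq_mul S (a.out * (r.out : M))
    rw [h2, hs, mul_assoc, hv _ _ (M.mul_mem (SetLike.coe_mem _) (hSM s.2)),
      hμ _ (SetLike.coe_mem _) _ (hSM s.2), hS _ s.2, mul_one, mul_comm]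
  -- Translating by m₀ multiplies the sum by μ m₀ ≠ 1. Summability plays no role at this point,
  -- since a divergent `tsum` is 0 anyway.
  have h2 : ∑' r : M ⧸ S.subgroupOf M, μ (r.out : M) = 0 := by
    have h3 : ∀ r : M ⧸ S.subgroupOf M,
        μ (((⟨m₀, hm₀⟩ : M) • r).out : M) = μ m₀ * μ (r.out : M) := by
      intro r
      have h4 : (⟨m₀, hm₀⟩ : M) • r = ((⟨m₀, hm₀⟩ * r.out : M) : M ⧸ S.subgroupOf M) := by
        conv_lhs => rw [← QuotientGroup.out_eq' r]
        rfl
      obtain ⟨s, hs⟩ := QuotientGroup.mk_out_eq_mul (S.subgroupOf M) (⟨m₀, hm₀⟩ * r.out : M)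
      have hs' : ((s : M) : G) ∈ S := s.2
      rw [h4, hs, Subgroup.coe_mul, hμ _ (SetLike.coe_mem _) _ (hSM hs'), hS _ hs', mul_one,
        Subgroup.coe_mul, hμ _ hm₀ _ (SetLike.coe_mem _)]
    have h5 := (MulAction.toPerm (⟨m₀, hm₀⟩ : M)).tsum_eq
      (fun r : M ⧸ S.subgroupOf M => μ (r.out : M))
    simp only [MulAction.toPerm_apply, h3, tsum_mul_left] at h5
    by_contra h0
    exact hne (mul_right_cancel₀ h0 (by rw [h5, one_mul]))
  have h3 := (e.symm.summable_iff).2 hsum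
  have h4 := e.symm.tsum_eq (fun q : G ⧸ S => v q.out)
  have h5 := h3.tsum_prod
  simp only [Function.comp_apply, h1, tsum_mul_left, h2, mul_zero, tsum_zero] at h4 h5
  rw [h5] at h4
  rw [h4]
  exact hsum.hasSum

/-- Expand the square. Diagonal terms are multiplied by the index of S, and off-diagonal terms carry
the character μ_i times the conjugate of μ_k on L_i ∩ L_k, nontrivial by `hne`, so they cancel. -/
theorem hasSum_quotient_norm_sq_sum {ι : Type*} {I : Finset ι} {S : Subgroup G}
    {L : ι → Subgroup G} {u μ : ι → G → ℂ} {A : ℝ} (C : ι → ℂ)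
    (hSL : ∀ i ∈ I, S ≤ L i) (hfin : ∀ i ∈ I, S.relIndex (L i) ≠ 0)
    (hu : ∀ i ∈ I, ∀ g, ∀ l ∈ L i, u i (g * l) = μ i l * u i g)
    (hμ : ∀ i ∈ I, ∀ l ∈ L i, ∀ m ∈ L i, μ i (l * m) = μ i l * μ i m)
    (hnorm : ∀ i ∈ I, ∀ l ∈ L i, ‖μ i l‖ = 1) (hS : ∀ i ∈ I, ∀ s ∈ S, μ i s = 1)
    (hne : ∀ i ∈ I, ∀ k ∈ I, i ≠ k → ∃ m ∈ L i ⊓ L k, μ i m ≠ μ k m)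
    (hA : ∀ i ∈ I, HasSum (fun q : G ⧸ L i => ‖u i q.out‖ ^ 2) A) :
    HasSum (fun q : G ⧸ S => ‖∑ i ∈ I, C i * u i q.out‖ ^ 2)
      (∑ i ∈ I, ‖C i‖ ^ 2 * (S.relIndex (L i) * A)) := by
  classical
  have hdiag : ∀ i ∈ I, HasSum (fun q : G ⧸ S => ‖u i q.out‖ ^ 2) (S.relIndex (L i) * A) :=
    fun i hi => hasSum_quotient_of_le (F := fun g => ‖u i g‖ ^ 2) (hSL i hi) (hfin i hi)
      (fun _ => by positivity)
      (fun g l hl => by rw [hu i hi g l hl, norm_mul, hnorm i hi l hl, one_mul]) (hA i hi)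
  have hcross : ∀ i ∈ I, ∀ k ∈ I, i ≠ k →
      HasSum (fun q : G ⧸ S => u i q.out * starRingEnd ℂ (u k q.out)) 0 := by
    intro i hi k hk hik
    obtain ⟨m, hm, hne⟩ := hne i hi k hk hik
    have hsq : ∀ l ∈ L k, μ k l * starRingEnd ℂ (μ k l) = 1 := fun l hl => by
      rw [Complex.mul_conj, Complex.normSq_eq_norm_sq, hnorm k hk l hl]
      simp
    refine hasSum_quotient_zero (M := L i ⊓ L k) (le_inf (hSL i hi) (hSL k hk))
      (v := fun g => u i g * starRingEnd ℂ (u k g))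
      (μ := fun g => μ i g * starRingEnd ℂ (μ k g)) ?_ ?_ ?_ hm ?_ ?_
    · intro g l hl
      simp only [hu i hi g l hl.1, hu k hk g l hl.2, map_mul]
      ring
    · intro l hl n hn
      simp only [hμ i hi l hl.1 n hn.1, hμ k hk l hl.2 n hn.2, map_mul]
      ring
    · intro s hs
      simp [hS i hi s hs, hS k hk s hs]
    · intro h
      refine hne ?_
      calc μ i m = (μ i m * starRingEnd ℂ (μ k m)) * μ k m := by
            rw [mul_assoc, mul_comm (starRingEnd ℂ _), hsq m hm.2, mul_one]
        _ = μ k m := by rw [h, one_mul]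
    -- The cross term is dominated by |u_i|² + |u_k|².
    · refine Summable.of_norm_bounded ((hdiag i hi).summable.add (hdiag k hk).summable) fun q => ?_
      rw [norm_mul, RCLike.norm_conj]
      nlinarith [sq_nonneg (‖u i q.out‖ - ‖u k q.out‖), sq_nonneg ‖u i q.out‖,
        sq_nonneg ‖u k q.out‖]
  have hterm : ∀ i ∈ I, ∀ k ∈ I,
      HasSum (fun q : G ⧸ S => C i * starRingEnd ℂ (C k) *
        (u i q.out * starRingEnd ℂ (u k q.out)))
        (if i = k then ((‖C i‖ ^ 2 * (S.relIndex (L i) * A) : ℝ) : ℂ) else 0) := by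
    intro i hi k hk
    split_ifs with hik
    · subst hik
      have h := (Complex.hasSum_ofReal.2 ((hdiag i hi).mul_left (‖C i‖ ^ 2)))
      convert h using 2 with q
      rw [Complex.mul_conj, Complex.mul_conj, Complex.normSq_eq_norm_sq, Complex.normSq_eq_norm_sq]
      push_cast
      ring
    · simpa using (hcross i hi k hk hik).mul_left (C i * starRingEnd ℂ (C k))
  have h := hasSum_sum fun i hi => hasSum_sum fun k hk => hterm i hi k hk
  rw [← Complex.hasSum_ofReal]
  convert h using 1
  · funext q
    rw [← Complex.normSq_eq_norm_sq, ← Complex.mul_conj, map_sum, Finset.sum_mul_sum]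
    refine Finset.sum_congr rfl fun i _ => Finset.sum_congr rfl fun k _ => ?_
    rw [map_mul]
    ring
  · rw [Complex.ofReal_sum]
    refine Finset.sum_congr rfl fun i hi => ?_
    rw [Finset.sum_ite_eq, if_pos hi]

end Cosets

/-! ### Indices of subgroups of the affine group -/

/-- The set of coordinate pairs of the elements of `affBall c A k`. -/
def affBallCoords (c : ℚ_[p]) (A : ℕ) (k : ℤ) : Set (ℚ_[p] × ℚ_[p]) :=
  {x | ‖x.1 - 1‖ < 1 ∧ ‖x.1 - 1‖ ≤ (p : ℝ) ^ (-(A : ℤ)) ∧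
    ‖x.2 + (x.1 - 1) * c‖ ≤ (p : ℝ) ^ k}

theorem mem_affBallCoords {c : ℚ_[p]} {A : ℕ} {k : ℤ} {x : ℚ_[p] × ℚ_[p]} :
    x ∈ affBallCoords c A k ↔ ∃ g ∈ affBall c A k, x = (g.a, g.b) := by
  constructor
  · intro h
    have h1 := norm_eq_one_of_norm_sub_one_lt h.1
    exact ⟨⟨x.1, x.2, norm_pos_iff.1 (h1 ▸ one_pos)⟩, h, rfl⟩
  · rintro ⟨g, hg, rfl⟩
    exact hg

theorem measurableSet_affBallCoords (c : ℚ_[p]) (A : ℕ) (k : ℤ) :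
    MeasurableSet (affBallCoords c A k) := by
  have h1 : IsOpen {x : ℚ_[p] × ℚ_[p] | ‖x.1 - 1‖ < 1} :=
    isOpen_lt (by fun_prop) continuous_const
  have h2 : IsClosed {x : ℚ_[p] × ℚ_[p] | ‖x.1 - 1‖ ≤ (p : ℝ) ^ (-(A : ℤ))} :=
    isClosed_le (by fun_prop) continuous_const
  have h3 : IsClosed {x : ℚ_[p] × ℚ_[p] | ‖x.2 + (x.1 - 1) * c‖ ≤ (p : ℝ) ^ k} :=
    isClosed_le (by fun_prop) continuous_const
  exact h1.measurableSet.inter (h2.measurableSet.inter h3.measurableSet)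

/-- Fubini: over each admissible a the fibre is a ball of radius p^k centred at -(a-1)c, whose
volume does not depend on c. -/
theorem haar_prod_affBallCoords (c : ℚ_[p]) {A : ℕ} (hA : 1 ≤ A) (k : ℤ) :
    ((haar p).prod (haar p)) (affBallCoords c A k) =
      ENNReal.ofReal ((p : ℝ) ^ (-(A : ℤ)) * (p : ℝ) ^ k) := by
  rw [Measure.prod_apply (measurableSet_affBallCoords c A k)]
  have h : ∀ x : ℚ_[p], haar p (Prod.mk x ⁻¹' affBallCoords c A k) =
      (Metric.closedBall (1 : ℚ_[p]) ((p : ℝ) ^ (-(A : ℤ)))).indicator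
        (fun _ => ENNReal.ofReal ((p : ℝ) ^ k)) x := by
    intro x
    by_cases hx : ‖x - 1‖ ≤ (p : ℝ) ^ (-(A : ℤ))
    · have hx' : ‖x - 1‖ < 1 := hx.trans_lt (zpow_lt_one_of_neg₀ one_lt_prime (by omega))
      rw [Set.indicator_of_mem (by rwa [Metric.mem_closedBall, dist_eq_norm]),
        ← haar_closedBall (-((x - 1) * c)) k]
      congr 1
      ext y
      simp only [affBallCoords, Set.mem_preimage, Set.mem_ofPred_eq, hx, hx', true_and,
        Metric.mem_closedBall, dist_eq_norm, sub_neg_eq_add]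
    · rw [Set.indicator_of_notMem (by rwa [Metric.mem_closedBall, dist_eq_norm]),
        show Prod.mk x ⁻¹' affBallCoords c A k = ∅ from
          Set.eq_empty_of_forall_notMem fun y hy => hx hy.2.1, measure_empty]
  simp_rw [h]
  rw [lintegral_indicator measurableSet_closedBall, setLIntegral_const, haar_closedBall,
    ← ENNReal.ofReal_mul (zpow_nonneg prime_pos.le _), mul_comm]

/-- For |a| = 1, left translation preserves the product of additive Haar measures, so volumes of
cosets can be compared without a Haar measure on the affine group. -/
theorem measurePreserving_affine_mul {g : AffGroup p} (hg : ‖g.a‖ = 1) :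
    MeasurePreserving (fun x : ℚ_[p] × ℚ_[p] => (g.a * x.1, g.b + g.a * x.2))
      ((haar p).prod (haar p)) ((haar p).prod (haar p)) := by
  have h1 : MeasurePreserving (fun x : ℚ_[p] => g.a * x) (haar p) (haar p) := by
    refine ⟨by fun_prop, ?_⟩
    have h := haar_map_div (p := p) (inv_ne_zero g.a_ne_zero)
    rw [norm_inv, hg, inv_one, ENNReal.ofReal_one, one_smul] at h
    simpa [mul_comm] using h
  exact h1.prod ((measurePreserving_add_left (haar p) g.b).comp h1)

/-- The left cosets of the small subgroup partition the large one into sets of equal volume, so the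
index is the ratio p^(-1)·p^l / (p^(-A)·p^k). -/
theorem relIndex_affBall {c d : ℚ_[p]} {A : ℕ} (hA : 1 ≤ A) {k l : ℤ}
    (hle : affBall c A k ≤ affBall d 1 l) :
    ((affBall c A k).relIndex (affBall d 1 l) : ℝ) = (p : ℝ) ^ ((A : ℤ) - 1 + l - k) := by
  let Q := affBall d 1 l ⧸ (affBall c A k).subgroupOf (affBall d 1 l)
  let ν := (haar p).prod (haar p)
  let rep : Q → AffGroup p := fun q => (q.out : affBall d 1 l)
  have hrep : ∀ q, rep q ∈ affBall d 1 l := fun q => SetLike.coe_mem _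
  have hrep' : ∀ q, ‖((rep q)⁻¹).a‖ = 1 := fun q =>
    norm_a_of_mem_affBall ((affBall d 1 l).inv_mem (hrep q))
  let E : Q → Set (ℚ_[p] × ℚ_[p]) := fun q =>
    (fun x => (((rep q)⁻¹).a * x.1, ((rep q)⁻¹).b + ((rep q)⁻¹).a * x.2)) ⁻¹' affBallCoords c A k
  have hE : ∀ q x, x ∈ E q ↔ ∃ g : AffGroup p, x = (g.a, g.b) ∧ (rep q)⁻¹ * g ∈ affBall c A k := by
    intro q x
    simp only [E, Set.mem_preimage]
    constructor
    · intro h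
      have h1 := norm_eq_one_of_norm_sub_one_lt h.1
      rw [norm_mul, hrep', one_mul] at h1
      exact ⟨⟨x.1, x.2, norm_pos_iff.1 (h1 ▸ one_pos)⟩, rfl, h⟩
    · rintro ⟨g, rfl, hg⟩
      exact hg
  have hmeas : ∀ q, MeasurableSet (E q) := fun q =>
    (measurePreserving_affine_mul (hrep' q)).measurable (measurableSet_affBallCoords c A k)
  have hvol : ∀ q, ν (E q) = ENNReal.ofReal ((p : ℝ) ^ (-(A : ℤ)) * (p : ℝ) ^ k) := fun q => by
    rw [← haar_prod_affBallCoords c hA]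
    exact (measurePreserving_affine_mul (hrep' q)).measure_preimage
      (measurableSet_affBallCoords c A k).nullMeasurableSet
  have hdisj : Pairwise (Function.onFun Disjoint E) := by
    intro q r hqr
    rw [Function.onFun, Set.disjoint_left]
    intro x hx hx'
    obtain ⟨g, rfl, hg⟩ := (hE q x).1 hx
    obtain ⟨g', hgg', hg'⟩ := (hE r _).1 hx'
    obtain rfl : g = g' := AffGroup.ext (congrArg Prod.fst hgg') (congrArg Prod.snd hgg')
    refine hqr ?_
    rw [← QuotientGroup.out_eq' q, ← QuotientGroup.out_eq' r]
    refine QuotientGroup.eq.2 ?_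
    rw [Subgroup.mem_subgroupOf]
    have := (affBall c A k).mul_mem hg ((affBall c A k).inv_mem hg')
    simpa [mul_assoc] using this
  have hunion : ⋃ q, E q = affBallCoords d 1 l := by
    ext x
    rw [Set.mem_iUnion, mem_affBallCoords]
    constructor
    · rintro ⟨q, hx⟩
      obtain ⟨g, rfl, hg⟩ := (hE q x).1 hx
      refine ⟨g, ?_, rfl⟩
      simpa using (affBall d 1 l).mul_mem (hrep q) (hle hg)
    · rintro ⟨g, hg, rfl⟩
      obtain ⟨s, hs⟩ := QuotientGroup.mk_out_eq_mul ((affBall c A k).subgroupOf (affBall d 1 l))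
        ⟨g, hg⟩
      refine ⟨((⟨g, hg⟩ : affBall d 1 l) : Q), (hE _ _).2 ⟨g, rfl, ?_⟩⟩
      have h1 : rep ((⟨g, hg⟩ : affBall d 1 l) : Q) = g * (s : affBall d 1 l) :=
        congrArg Subtype.val hs
      rw [h1]
      simpa using (show ((s : affBall d 1 l) : AffGroup p) ∈ affBall c A k from s.2)
  have hpos : 0 < (p : ℝ) ^ (-(A : ℤ)) * (p : ℝ) ^ k :=
    mul_pos (zpow_pos prime_pos _) (zpow_pos prime_pos _)
  -- Infinitely many disjoint sets of the same positive measure do not fit into a set of finite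
  -- measure. This excludes the default value 0 of `relIndex`.
  have hfin : Finite Q := by
    have := Measure.finite_const_le_meas_of_disjoint_iUnion ν (ENNReal.ofReal_pos.2 hpos) hmeas hdisj
      (by rw [hunion, haar_prod_affBallCoords d le_rfl]; exact ENNReal.ofReal_ne_top)
    simp only [hvol, le_refl, Set.ofPred_true] at this
    exact Set.finite_univ_iff.1 this
  have hsum := measure_iUnion (μ := ν) hdisj hmeas
  have := Fintype.ofFinite Q
  rw [hunion, haar_prod_affBallCoords d le_rfl, tsum_fintype] at hsum
  simp only [hvol, Finset.sum_const, Finset.card_univ, nsmul_eq_mul] at hsum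
  rw [← ENNReal.ofReal_natCast, ← ENNReal.ofReal_mul (Nat.cast_nonneg _),
    ENNReal.ofReal_eq_ofReal_iff (by have := prime_pos (p := p); positivity)
      (by have := prime_pos (p := p); positivity), ← Nat.card_eq_fintype_card] at hsum
  change (Nat.card Q : ℝ) = _
  rw [← zpow_add₀ prime_pos.ne', ← zpow_add₀ prime_pos.ne', ← div_eq_iff (zpow_pos prime_pos _).ne',
    ← zpow_sub₀ prime_pos.ne'] at hsum
  rw [← hsum]
  congr 1
  push_cast
  ring

/-! ### Parseval's identity for coherent states -/

/-- One coherent state per coset of eKe⁻¹ gives an orthonormal family: distinct cosets are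
orthogonal, and within a coset only a phase changes, so totality of all coherent states makes the
family a Hilbert basis. -/
theorem hasSum_norm_inner_coherent (e : AffGroup p) {m : ℤ} (hm : ‖e.a‖ = (p : ℝ) ^ m) (g : L2 p) :
    HasSum (fun q : AffGroup p ⧸ affBall e.b 1 m => ‖inner ℂ g (coherent (q.out * e))‖ ^ 2)
      (‖g‖ ^ 2) := by
  have hconj : ∀ s : AffGroup p, e⁻¹ * s * e ∈ affBall (0 : ℚ_[p]) 1 0 ↔ s ∈ affBall e.b 1 m := by
    intro s
    rw [conj_mem_affBall hm, mul_zero, add_zero, zero_add]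
  let v : AffGroup p ⧸ affBall e.b 1 m → L2 p := fun q => coherent (q.out * e)
  have hon : Orthonormal ℂ v := by
    refine ⟨fun q => norm_coherent _, fun q r hqr => inner_coherent_eq_zero fun h => hqr ?_⟩
    rw [show (q.out * e)⁻¹ * (r.out * e) = e⁻¹ * (q.out⁻¹ * r.out) * e by group, hconj] at h
    rw [← QuotientGroup.out_eq' q, ← QuotientGroup.out_eq' r]
    exact QuotientGroup.eq.2 h
  have hbot : (Submodule.span ℂ (Set.range v))ᗮ = ⊥ := by
    rw [Submodule.eq_bot_iff]
    intro x hx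
    rw [Submodule.mem_orthogonal] at hx
    refine eq_zero_of_orthogonal_coherent fun h => ?_
    -- Write h = (h e⁻¹) e; the chosen representative of the coset of h e⁻¹ reproduces G(h)ψ up to a
    -- nonzero phase.
    obtain ⟨s, hs⟩ := QuotientGroup.mk_out_eq_mul (affBall e.b 1 m) (h * e⁻¹)
    have h1 := hx _ (Submodule.subset_span ⟨((h * e⁻¹ : AffGroup p) : AffGroup p ⧸ affBall e.b 1 m),
      rfl⟩)
    have h2 : h * e⁻¹ * s * e = h * (e⁻¹ * s * e) := by group
    simp only [v] at h1
    rw [hs, h2, coherent_mul h ((hconj _).2 s.2), inner_smul_left, mul_eq_zero] at h1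
    refine h1.resolve_left fun h0 => ?_
    have h3 := norm_lam (e⁻¹ * (s : AffGroup p) * e)
    rw [(map_eq_zero _).1 h0, norm_zero] at h3
    exact zero_ne_one h3
  have h := (HilbertBasis.mkOfOrthogonalEqBot hon hbot).hasSum_inner_mul_inner g g
  rw [HilbertBasis.coe_mkOfOrthogonalEqBot] at h
  have h1 : ∀ q, (inner ℂ g (v q) * inner ℂ (v q) g : ℂ) =
      ((‖(inner ℂ g (v q) : ℂ)‖ ^ 2 : ℝ) : ℂ) := fun q => by
    rw [← inner_conj_symm (v q) g, Complex.mul_conj, Complex.normSq_eq_norm_sq]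
  have h2 : (inner ℂ g g : ℂ) = ((‖g‖ ^ 2 : ℝ) : ℂ) := by
    rw [inner_self_eq_norm_sq_to_K]
    simp
  simp_rw [h1] at h
  rw [h2] at h
  exact Complex.hasSum_ofReal.1 h

/-! ### Wavelets as coherent states -/

theorem WaveletIndex.norm_freq (i : WaveletIndex p) : ‖(i.freq : ℚ_[p])‖ = 1 := by
  have h := Finset.mem_Icc.1 i.freq_mem
  rw [Padic.norm_natCast_eq_one_iff, hp.out.coprime_iff_not_dvd]
  exact Nat.not_dvd_of_pos_of_lt (by omega) (by omega)

theorem WaveletIndex.freq_ne_zero (i : WaveletIndex p) : (i.freq : ℚ_[p]) ≠ 0 :=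
  norm_pos_iff.1 (i.norm_freq ▸ one_pos)

/-- The affine map that transforms the basic wavelet into the wavelet with index `i`. -/
noncomputable def WaveletIndex.elt (i : WaveletIndex p) : AffGroup p where
  a := (p : ℚ_[p]) ^ (-i.scale) / i.freq
  b := (p : ℚ_[p]) ^ (-i.scale) * i.shift
  a_ne_zero := div_ne_zero (zpow_ne_zero _ prime_ne_zero) i.freq_ne_zero

theorem WaveletIndex.elt_a (i : WaveletIndex p) :
    i.elt.a = (p : ℚ_[p]) ^ (-i.scale) / i.freq := rfl

theorem WaveletIndex.elt_b (i : WaveletIndex p) :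
    i.elt.b = (p : ℚ_[p]) ^ (-i.scale) * i.shift := rfl

theorem WaveletIndex.norm_elt_a (i : WaveletIndex p) : ‖i.elt.a‖ = (p : ℝ) ^ i.scale := by
  rw [WaveletIndex.elt_a, norm_div, i.norm_freq, div_one, Padic.norm_p_zpow, neg_neg]

theorem wavelet_eq_smul_psi (i : WaveletIndex p) : wavelet i = i.elt • psi p := by
  funext x
  have hj := i.freq_ne_zero
  have h0 := zpow_ne_zero i.scale (prime_ne_zero (p := p))
  have h1 : (x - i.elt.b) / i.elt.a = i.freq * ((p : ℚ_[p]) ^ i.scale * x - i.shift) := by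
    rw [WaveletIndex.elt_a, WaveletIndex.elt_b, zpow_neg]
    field_simp
  have h2 : ‖i.elt.a‖ ^ (-(1 / 2) : ℝ) = (p : ℝ) ^ (-(i.scale : ℝ) / 2) := by
    rw [i.norm_elt_a, ← Real.rpow_intCast, ← Real.rpow_mul prime_pos.le]
    ring_nf
  rw [smul_apply, h1, h2, wavelet, psi, norm_mul, i.norm_freq, one_mul, mul_assoc, mul_ite,
    mul_zero]

theorem stabilizer_wavelet (i : WaveletIndex p) :
    MulAction.stabilizer (AffGroup p) (wavelet i) = affBall i.elt.b 1 (i.scale - 1) := by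
  ext g
  have h := conj_mem_affBall (c := 0) (A := 1) (k := -1) (s := g) i.norm_elt_a
  rw [mul_zero, add_zero, neg_add_eq_sub] at h
  rw [← h, ← stabilizer_psi, MulAction.mem_stabilizer_iff, MulAction.mem_stabilizer_iff,
    wavelet_eq_smul_psi, mul_smul, mul_smul, inv_smul_eq_iff]

theorem conj_elt_mem_iff (i : WaveletIndex p) (g : AffGroup p) :
    i.elt⁻¹ * g * i.elt ∈ affBall (0 : ℚ_[p]) 1 0 ↔ g ∈ affBall i.elt.b 1 i.scale := by
  rw [conj_mem_affBall i.norm_elt_a, mul_zero, add_zero, zero_add]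

/-- Being in the same coset of K determines γ through |a|, then j through a modulo p, then n as a
standard representative modulo ℤ_p. -/
theorem inv_elt_mul_elt_notMem {i k : WaveletIndex p} (hik : i ≠ k) :
    i.elt⁻¹ * k.elt ∉ affBall (0 : ℚ_[p]) 1 0 := by
  intro h
  have h0 := prime_ne_zero (p := p)
  have hi := i.freq_ne_zero
  have hk := k.freq_ne_zero
  rw [mem_affBall_one_iff, mul_zero, add_zero, zpow_zero, AffGroup.mul_a, AffGroup.mul_b,
    AffGroup.inv_a, AffGroup.inv_b] at h
  obtain ⟨h1, h2⟩ := h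
  have hs : k.scale = i.scale := by
    have h3 := norm_eq_one_of_norm_sub_one_lt h1
    rw [norm_mul, norm_inv, i.norm_elt_a, k.norm_elt_a, inv_mul_eq_one₀
      (zpow_pos prime_pos _).ne'] at h3
    exact (zpow_right_injective₀ prime_pos one_lt_prime.ne' h3).symm
  have hf : k.freq = i.freq := by
    have h3 : (i.elt.a)⁻¹ * k.elt.a = i.freq / k.freq := by
      simp only [WaveletIndex.elt, hs]
      have := zpow_ne_zero (-i.scale) h0
      field_simp
    rw [h3, div_sub_one hk, norm_div, k.norm_freq, div_one, ← norm_le_inv_prime_iff] at h1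
    have hi' := Finset.mem_Icc.1 i.freq_mem
    have hk' := Finset.mem_Icc.1 k.freq_mem
    exact (natCast_eq_of_norm_sub_le (p := p) (N := 1) (by rw [pow_one]; omega)
      (by rw [pow_one]; omega) (by simpa using h1)).symm
  have hn : k.shift = i.shift := by
    refine eq_of_mem_reps_of_norm_sub_le k.shift_mem i.shift_mem ?_
    have h3 : -i.elt.b * i.elt.a⁻¹ + i.elt.a⁻¹ * k.elt.b = i.freq * (k.shift - i.shift) := by
      simp only [WaveletIndex.elt, hs]
      have := zpow_ne_zero (-i.scale) h0
      field_simp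
      ring
    rw [h3, norm_mul, i.norm_freq, one_mul] at h2
    simpa using h2
  apply hik
  obtain ⟨s, n, hn1, f, hf1⟩ := i
  obtain ⟨s', n', hn1', f', hf1'⟩ := k
  simp only at hs hf hn
  subst hs hf hn
  rfl

/-! ### The stabilizer of a generic function -/

theorem exists_isLeast_scales {C : WaveletIndex p →₀ ℂ} (hC : C.support.Nonempty) :
    ∃ i ∈ C.support, (∀ k ∈ C.support, i.scale ≤ k.scale) ∧ IsLeast (scales C) i.scale := by
  obtain ⟨i, hi, h⟩ := C.support.exists_min_image (fun i => i.scale) hC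
  refine ⟨i, hi, h, ⟨i, hi, rfl⟩, ?_⟩
  rintro _ ⟨k, hk, rfl⟩
  exact h k hk

theorem finite_radii (C : WaveletIndex p →₀ ℂ) : (radii C).Finite := by
  classical
  refine (Set.finite_singleton _).union (((C.support ×ˢ C.support).image fun x =>
    max ((p : ℝ) ^ (x.1.scale - 1)) ((p : ℝ) ^ (x.2.scale - 1)) /
        ‖(p : ℚ_[p]) ^ (-x.1.scale) * x.1.shift -
          (p : ℚ_[p]) ^ (-x.2.scale) * x.2.shift‖).finite_toSet.subset ?_)
  rintro r ⟨i, hi, k, hk, -, rfl⟩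
  rw [Finset.mem_coe, Finset.mem_image]
  exact ⟨(i, k), Finset.mem_product.2 ⟨hi, hk⟩, rfl⟩

theorem exists_eq_zpow_of_mem_radii {C : WaveletIndex p →₀ ℂ} {r : ℝ} (hr : r ∈ radii C) :
    ∃ n : ℤ, r = (p : ℝ) ^ n := by
  rcases hr with rfl | ⟨i, -, k, -, hne, rfl⟩
  · exact ⟨-1, by simp⟩
  · obtain ⟨n, hn⟩ := exists_norm_eq_zpow hne
    rw [hn]
    rcases max_choice ((p : ℝ) ^ (i.scale - 1)) ((p : ℝ) ^ (k.scale - 1)) with h | h <;> rw [h]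
    · exact ⟨i.scale - 1 - n, (zpow_sub₀ prime_pos.ne' _ _).symm⟩
    · exact ⟨k.scale - 1 - n, (zpow_sub₀ prime_pos.ne' _ _).symm⟩

/-- The set is finite and consists of powers of p; its member p⁻¹ forces A ≥ 1. -/
theorem exists_isLeast_radii (C : WaveletIndex p →₀ ℂ) :
    ∃ A : ℕ, 1 ≤ A ∧ IsLeast (radii C) ((p : ℝ) ^ (-(A : ℤ))) := by
  obtain ⟨r, hr, hmin⟩ := Set.exists_min_image (radii C) id (finite_radii C)
    ⟨_, Or.inl rfl⟩
  obtain ⟨n, rfl⟩ := exists_eq_zpow_of_mem_radii hr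
  have h1 : (p : ℝ) ^ n ≤ (p : ℝ) ^ (-1 : ℤ) := by
    simpa using hmin _ (Or.inl rfl)
  have h2 : n ≤ -1 := (zpow_le_zpow_iff_right₀ one_lt_prime).1 h1
  refine ⟨(-n).toNat, by omega, ?_⟩
  rw [show -((-n).toNat : ℤ) = n by omega]
  exact ⟨hr, hmin⟩

/-- Fixing ψ_i means |a-1| < 1 and displacing the centre b_i by at most p^(γ_i-1). Subtracting these
conditions for i and k bounds |a-1||b_i - b_k|, which is how the radii arise. Conversely, once |a-1|
is below every radius, the condition at a centre of minimal scale implies all the others. -/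
theorem iInf_stabilizer_wavelet {C : WaveletIndex p →₀ ℂ} {i₀ : WaveletIndex p}
    (hi₀ : i₀ ∈ C.support) (hmin : ∀ i ∈ C.support, i₀.scale ≤ i.scale) {A : ℕ} (hA : 1 ≤ A)
    (hleast : IsLeast (radii C) ((p : ℝ) ^ (-(A : ℤ)))) :
    ⨅ i ∈ C.support, MulAction.stabilizer (AffGroup p) (wavelet i) =
      affBall i₀.elt.b A (i₀.scale - 1) := by
  ext g
  simp only [Subgroup.mem_iInf, stabilizer_wavelet, mem_affBall_one_iff]
  rw [mem_affBall_iff hA]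
  constructor
  · intro h
    refine ⟨?_, (h i₀ hi₀).2⟩
    rcases hleast.1 with h1 | ⟨i, hi, k, hk, hne, h1⟩
    · rw [Set.mem_singleton_iff] at h1
      rw [h1, norm_le_inv_prime_iff]
      exact (h i₀ hi₀).1
    · rw [h1, le_div_iff₀ (norm_pos_iff.2 hne), ← norm_mul]
      have h2 := norm_sub_le_of_le ((h i hi).2.trans (le_max_left _ ((p : ℝ) ^ (k.scale - 1))))
        ((h k hk).2.trans (le_max_right _ _))
      rwa [add_sub_add_left_eq_sub, ← mul_sub, WaveletIndex.elt_b, WaveletIndex.elt_b] at h2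
  · rintro ⟨h1, h2⟩ i hi
    refine ⟨h1.trans_lt (zpow_lt_one_of_neg₀ one_lt_prime (by omega)), ?_⟩
    have hle : (p : ℝ) ^ (i₀.scale - 1) ≤ (p : ℝ) ^ (i.scale - 1) :=
      zpow_le_zpow_right₀ one_lt_prime.le (by have := hmin i hi; omega)
    have h3 : ‖(g.a - 1) * (i.elt.b - i₀.elt.b)‖ ≤ (p : ℝ) ^ (i.scale - 1) := by
      by_cases hne : i.elt.b - i₀.elt.b = 0
      · rw [hne, mul_zero, norm_zero]
        exact zpow_nonneg prime_pos.le _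
      -- Use the radius of the pair (i, i₀); its maximum is p^(γ_i-1) because γ₀ is minimal.
      · have h4 := h1.trans (hleast.2 (Or.inr ⟨i, hi, i₀, hi₀, hne, rfl⟩))
        rw [max_eq_left hle, ← WaveletIndex.elt_b, ← WaveletIndex.elt_b,
          le_div_iff₀ (norm_pos_iff.2 hne)] at h4
        rwa [norm_mul]
    convert norm_add_le_of_le (h2.trans hle) h3 using 2
    ring

/-! ### The parametrization of the orbit -/

theorem OrbitIndex.norm_dil {γ₀ : ℤ} {A : ℕ} (t : OrbitIndex p γ₀ A) : ‖(t.dil : ℚ_[p])‖ = 1 := by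
  rw [Padic.norm_natCast_eq_one_iff, hp.out.coprime_iff_not_dvd]
  exact t.not_dvd_dil

theorem OrbitIndex.norm_elt_a {γ₀ : ℤ} {A : ℕ} (t : OrbitIndex p γ₀ A) :
    ‖t.elt.a‖ = (p : ℝ) ^ (-t.scale) := by
  rw [OrbitIndex.elt, norm_mul, t.norm_dil, mul_one, Padic.norm_p_zpow]

/-- The coset condition decouples: once the scale is fixed, the first inequality determines J modulo
p^A, and then the second determines n modulo p^(1-γ₀). The centre c only shifts the number that n
approximates. -/
theorem OrbitIndex.inv_elt_mul_mem_iff {γ₀ : ℤ} {A : ℕ} (hA : 1 ≤ A) (t : OrbitIndex p γ₀ A)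
    (c : ℚ_[p]) (h : AffGroup p) :
    t.elt⁻¹ * h ∈ affBall c A (γ₀ - 1) ↔
      ‖h.a / (p : ℚ_[p]) ^ t.scale - t.dil‖ ≤ (p : ℝ) ^ (-(A : ℤ)) ∧
      ‖h.b / t.elt.a + (h.a / t.elt.a - 1) * c - t.shift‖ ≤ (p : ℝ) ^ (-(1 - γ₀)) := by
  have ha := t.elt.a_ne_zero
  have hd : (t.dil : ℚ_[p]) ≠ 0 := norm_pos_iff.1 (t.norm_dil ▸ one_pos)
  have h0 := zpow_ne_zero t.scale (prime_ne_zero (p := p))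
  have h1 : (t.elt⁻¹ * h).a - 1 = (h.a / (p : ℚ_[p]) ^ t.scale - t.dil) / t.dil := by
    rw [AffGroup.mul_a, AffGroup.inv_a, OrbitIndex.elt]
    field_simp
  have h2 : (t.elt⁻¹ * h).b + ((t.elt⁻¹ * h).a - 1) * c =
      h.b / t.elt.a + (h.a / t.elt.a - 1) * c - t.shift := by
    have hb : t.elt.b = t.elt.a * t.shift := rfl
    rw [AffGroup.mul_a, AffGroup.mul_b, AffGroup.inv_a, AffGroup.inv_b, hb]
    field_simp
    ring
  rw [mem_affBall_iff hA, h2, h1, norm_div, t.norm_dil, div_one, neg_sub]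

theorem exists_orbitIndex (c : ℚ_[p]) (γ₀ : ℤ) {A : ℕ} (hA : 1 ≤ A) (h : AffGroup p) :
    ∃ t : OrbitIndex p γ₀ A, t.elt⁻¹ * h ∈ affBall c A (γ₀ - 1) := by
  have hu : ‖h.a / (p : ℚ_[p]) ^ h.a.valuation‖ = 1 := by
    rw [norm_div, Padic.norm_p_zpow, Padic.norm_eq_zpow_neg_valuation h.a_ne_zero]
    exact div_self (zpow_pos prime_pos _).ne'
  obtain ⟨k, hk, hk'⟩ := exists_natCast_norm_sub_le hu.le A
  have hlt : (p : ℝ) ^ (-(A : ℤ)) < 1 := zpow_lt_one_of_neg₀ one_lt_prime (by omega)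
  -- k lies within p^(-A) < 1 of a unit, hence is a unit itself.
  have hdvd : ¬ p ∣ k := by
    intro hd
    rw [← Padic.norm_natCast_lt_one_iff] at hd
    have h1 := Padic.norm_eq_of_norm_sub_lt_left (hk'.trans_lt (hlt.trans_eq hu.symm))
    rw [hu] at h1
    exact hd.ne h1.symm
  let a : ℚ_[p] := (p : ℚ_[p]) ^ h.a.valuation * k
  obtain ⟨n, hn, hn'⟩ := exists_mem_reps (1 - γ₀) (h.b / a + (h.a / a - 1) * c)
  let t : OrbitIndex p γ₀ A := ⟨h.a.valuation, n, hn, k, hk, hdvd⟩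
  exact ⟨t, (t.inv_elt_mul_mem_iff hA c h).2 ⟨hk', hn'⟩⟩

theorem orbitIndex_eq_of_mem {c : ℚ_[p]} {γ₀ : ℤ} {A : ℕ} (hA : 1 ≤ A) {h : AffGroup p}
    {t t' : OrbitIndex p γ₀ A} (ht : t.elt⁻¹ * h ∈ affBall c A (γ₀ - 1))
    (ht' : t'.elt⁻¹ * h ∈ affBall c A (γ₀ - 1)) : t = t' := by
  have hs : t.scale = t'.scale := by
    have h1 := norm_a_of_mem_affBall ht
    have h2 := norm_a_of_mem_affBall ht'
    rw [AffGroup.mul_a, AffGroup.inv_a, norm_mul, norm_inv, OrbitIndex.norm_elt_a,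
      inv_mul_eq_one₀ (zpow_pos prime_pos _).ne'] at h1 h2
    have := zpow_right_injective₀ prime_pos one_lt_prime.ne' (h1.trans h2.symm)
    omega
  rw [OrbitIndex.inv_elt_mul_mem_iff hA] at ht ht'
  have hd : t.dil = t'.dil := by
    refine natCast_eq_of_norm_sub_le t.dil_lt t'.dil_lt ?_
    have h1 := ht.1
    rw [hs] at h1
    convert norm_sub_le_of_le ht'.1 h1 using 2
    ring
  have ha : t.elt.a = t'.elt.a := by simp only [OrbitIndex.elt, hs, hd]
  have hn : t.shift = t'.shift := by
    refine eq_of_mem_reps_of_norm_sub_le t.shift_mem t'.shift_mem ?_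
    have h1 := ht.2
    rw [ha] at h1
    convert norm_sub_le_of_le ht'.2 h1 using 2
    ring
  obtain ⟨s, n, hn1, d, hd1, hd2⟩ := t
  obtain ⟨s', n', hn1', d', hd1', hd2'⟩ := t'
  simp only at hs hd hn
  subst hs hd hn
  rfl

theorem bijective_orbitIndex {f : ℚ_[p] → ℂ} {c : ℚ_[p]} {γ₀ : ℤ} {A : ℕ} (hA : 1 ≤ A)
    (hf : MulAction.stabilizer (AffGroup p) f = affBall c A (γ₀ - 1)) :
    Function.Bijective (fun t : OrbitIndex p γ₀ A =>
      (⟨t.elt • f, MulAction.mem_orbit f t.elt⟩ : MulAction.orbit (AffGroup p) f)) := by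
  constructor
  · intro t t' htt'
    have h1 : t.elt • f = t'.elt • f := congrArg Subtype.val htt'
    refine orbitIndex_eq_of_mem (c := c) hA (h := t'.elt) ?_ ?_
    · rw [← hf, MulAction.mem_stabilizer_iff, mul_smul, inv_smul_eq_iff, h1]
    · rw [inv_mul_cancel]
      exact one_mem _
  · rintro ⟨_, h, rfl⟩
    obtain ⟨t, ht⟩ := exists_orbitIndex c γ₀ hA h
    rw [← hf, MulAction.mem_stabilizer_iff, mul_smul, inv_smul_eq_iff] at ht
    exact ⟨t, Subtype.ext ht.symm⟩

/-! ### The frame property -/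

theorem toL2_smul_eq_sum {f : ℚ_[p] → ℂ} (hf : f ∈ D0 p) {C : WaveletIndex p →₀ ℂ}
    (hC : f = ∑ i ∈ C.support, C i • wavelet i) (h : AffGroup p) :
    toL2 (h • f) (smul_mem_D0 h hf) = ∑ i ∈ C.support, C i • coherent (h * i.elt) := by
  have h1 : (⟨h • f, smul_mem_D0 h hf⟩ : D0 p) = ∑ i ∈ C.support,
      C i • (⟨(h * i.elt) • psi p, smul_mem_D0 _ psi_mem_D0⟩ : D0 p) := by
    refine Subtype.ext ?_
    simp only [AddSubmonoidClass.coe_finsetSum, Submodule.coe_smul]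
    rw [hC, AffGroup.smul_finset_sum]
    refine Finset.sum_congr rfl fun i _ => ?_
    rw [wavelet_eq_smul_psi, mul_smul]
  have h2 := congrArg (toL2Linear p) h1
  rw [map_sum] at h2
  simp_rw [map_smul] at h2
  exact h2

/-- Here L_i is the stabilizer of the line of ψ_i and μ_i the character by which it acts. The index
exponent is A - 1 + γ_i - (γ₀ - 1) = A - γ₀ + γ_i. -/
theorem hasSum_norm_inner_quotient {f : ℚ_[p] → ℂ} (hf : f ∈ D0 p) {C : WaveletIndex p →₀ ℂ}
    (hC : f = ∑ i ∈ C.support, C i • wavelet i) {c : ℚ_[p]} {γ₀ : ℤ} {A : ℕ} (hA : 1 ≤ A)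
    (hle : ∀ i ∈ C.support,
      affBall c A (γ₀ - 1) ≤ MulAction.stabilizer (AffGroup p) (wavelet i)) (g : L2 p) :
    HasSum (fun q : AffGroup p ⧸ affBall c A (γ₀ - 1) =>
        ‖inner ℂ g (toL2 (q.out • f) (smul_mem_D0 _ hf))‖ ^ 2)
      ((∑ i ∈ C.support, ‖C i‖ ^ 2 * (p : ℝ) ^ ((A : ℤ) - γ₀ + i.scale)) * ‖g‖ ^ 2) := by
  have hstab : ∀ i : WaveletIndex p,
      MulAction.stabilizer (AffGroup p) (wavelet i) ≤ affBall i.elt.b 1 i.scale := fun i s hs => by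
    rw [stabilizer_wavelet] at hs
    exact ⟨hs.1, hs.2.1, hs.2.2.trans (zpow_le_zpow_right₀ one_lt_prime.le (by omega))⟩
  have hle' : ∀ i ∈ C.support, affBall c A (γ₀ - 1) ≤ affBall i.elt.b 1 i.scale := fun i hi =>
    (hle i hi).trans (hstab i)
  have hidx : ∀ i ∈ C.support, ((affBall c A (γ₀ - 1)).relIndex (affBall i.elt.b 1 i.scale) : ℝ) =
      (p : ℝ) ^ ((A : ℤ) - γ₀ + i.scale) := fun i hi => by
    rw [relIndex_affBall hA (hle' i hi)]
    congr 1
    ring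
  have key := hasSum_quotient_norm_sq_sum (I := C.support) (S := affBall c A (γ₀ - 1))
    (L := fun i => affBall i.elt.b 1 i.scale)
    (u := fun i h => inner ℂ g (coherent (h * i.elt)))
    (μ := fun i h => lam (i.elt⁻¹ * h * i.elt)) (A := ‖g‖ ^ 2) C hle' ?_ ?_ ?_
    (fun _ _ _ _ => norm_lam _) ?_ ?_ (fun i _ => hasSum_norm_inner_coherent i.elt i.norm_elt_a g)
  · convert key using 1
    · funext q
      rw [toL2_smul_eq_sum hf hC, inner_sum]
      simp_rw [inner_smul_right]
    · rw [Finset.sum_mul]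
      refine Finset.sum_congr rfl fun i hi => ?_
      rw [hidx i hi, mul_assoc]
  · intro i hi h0
    have h1 := hidx i hi
    rw [h0, Nat.cast_zero] at h1
    exact (zpow_pos prime_pos _).ne h1
  · intro i _ h l hl
    rw [show h * l * i.elt = h * i.elt * (i.elt⁻¹ * l * i.elt) by group,
      coherent_mul _ ((conj_elt_mem_iff i l).2 hl), inner_smul_right]
  · intro i _ l hl m hm
    rw [← lam_mul ((conj_elt_mem_iff i l).2 hl) ((conj_elt_mem_iff i m).2 hm)]
    congr 1
    group
  -- The phase is trivial on S because S fixes the wavelet itself, not just its line.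
  · intro i hi s hs
    have h1 := hle i hi hs
    have h2 := conj_mem_affBall (c := 0) (A := 1) (k := -1) (s := s) i.norm_elt_a
    rw [mul_zero, add_zero, neg_add_eq_sub, ← stabilizer_wavelet] at h2
    have h3 := (mem_affBall_one_iff.1 (h2.2 h1)).2
    rw [mul_zero, add_zero, zpow_neg_one, norm_le_inv_prime_iff] at h3
    rwa [lam, chi_eq_one_iff, norm_neg, norm_inv_prime_mul_le_one_iff]
  -- Distinct indices give e_i⁻¹e_k outside K, hence an s at which λ and its conjugate differ; e_i s
  -- e_i⁻¹ is the required element of L_i ∩ L_k.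
  · intro i _ k _ hik
    obtain ⟨s, hs, hs', hne⟩ := exists_lam_ne_lam_conj (inv_elt_mul_elt_notMem hik)
    have h1 : i.elt⁻¹ * (i.elt * s * i.elt⁻¹) * i.elt = s := by group
    have h2 : k.elt⁻¹ * (i.elt * s * i.elt⁻¹) * k.elt =
      (i.elt⁻¹ * k.elt)⁻¹ * s * (i.elt⁻¹ * k.elt) := by group
    refine ⟨i.elt * s * i.elt⁻¹, ⟨(conj_elt_mem_iff i _).1 (by rwa [h1]),
      (conj_elt_mem_iff k _).1 (by rwa [h2])⟩, ?_⟩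
    rwa [h1, h2]

theorem hasSum_norm_inner_orbit {f : ℚ_[p] → ℂ} (hf : f ∈ D0 p) {g : L2 p} {B : ℝ}
    {S : Subgroup (AffGroup p)} (hS : MulAction.stabilizer (AffGroup p) f = S)
    (h : HasSum (fun q : AffGroup p ⧸ S =>
      ‖inner ℂ g (toL2 (q.out • f) (smul_mem_D0 _ hf))‖ ^ 2) B) :
    HasSum (fun u : MulAction.orbit (AffGroup p) f =>
      ‖inner ℂ g (toL2 (u : ℚ_[p] → ℂ) (mem_D0_of_mem_orbit hf u.2))‖ ^ 2) B := by
  subst hS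
  rw [← (MulAction.orbitEquivQuotientStabilizer (AffGroup p) f).symm.hasSum_iff]
  convert h using 1
  funext q
  have h1 : ((MulAction.orbitEquivQuotientStabilizer (AffGroup p) f).symm q : ℚ_[p] → ℂ) =
      q.out • f := by
    conv_lhs => rw [← QuotientGroup.out_eq' q]
    exact MulAction.orbitEquivQuotientStabilizer_symm_apply _ _ _
  rw [Function.comp_apply, toL2_congr h1]

end PadicWavelet

theorem mainTheorem1 (p : ℕ) [Fact p.Prime] (f : ℚ_[p] → ℂ) (hf : f ∈ PadicWavelet.D0 p)
    (hf0 : f ≠ 0) (C : PadicWavelet.WaveletIndex p →₀ ℂ)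
    (hC : f = ∑ i ∈ C.support, C i • PadicWavelet.wavelet i)
    (hgen : PadicWavelet.IsGeneric f C) :
    ∃ (γ₀ : ℤ) (γA : ℕ),
      IsLeast (PadicWavelet.scales C) γ₀ ∧
      IsLeast (PadicWavelet.radii C) ((p : ℝ) ^ (-(γA : ℤ))) ∧
      -- the functions `G(p^γ J, p^γ J n) f` parametrize the orbit of `f`
      Function.Injective (fun t : PadicWavelet.OrbitIndex p γ₀ γA => t.elt • f) ∧
      Set.range (fun t : PadicWavelet.OrbitIndex p γ₀ γA => t.elt • f) =
        MulAction.orbit (PadicWavelet.AffGroup p) f ∧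
      -- the family `G(p^γ J, p^γ J n) f` is a uniform tight frame in `L²(ℚ_p)`
      PadicWavelet.IsUniformTightFrame
        (fun t : PadicWavelet.OrbitIndex p γ₀ γA =>
          PadicWavelet.toL2 (t.elt • f) (PadicWavelet.smul_mem_D0 t.elt hf))
        (∑ i ∈ C.support, ‖C i‖ ^ 2 * (p : ℝ) ^ ((γA : ℤ) - γ₀ + i.scale)) ∧
      -- the orbit, as a set of functions, is a uniform tight frame in `L²(ℚ_p)`
      PadicWavelet.IsUniformTightFrame
        (fun u : MulAction.orbit (PadicWavelet.AffGroup p) f =>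
          PadicWavelet.toL2 (u : ℚ_[p] → ℂ) (PadicWavelet.mem_D0_of_mem_orbit hf u.2))
        (∑ i ∈ C.support, ‖C i‖ ^ 2 * (p : ℝ) ^ ((γA : ℤ) - γ₀ + i.scale)) := by
  -- Since f ≠ 0 some coefficient survives: this gives both the existence of γ₀ and the positivity
  -- of the frame constant.
  have hne : C.support.Nonempty := by
    rw [Finset.nonempty_iff_ne_empty]
    intro h
    rw [h, Finset.sum_empty] at hC
    exact hf0 hC
  obtain ⟨i₀, hi₀, hmin, hγ₀⟩ := PadicWavelet.exists_isLeast_scales hne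
  obtain ⟨A, hA, hleast⟩ := PadicWavelet.exists_isLeast_radii C
  have hstab := hgen.trans (PadicWavelet.iInf_stabilizer_wavelet hi₀ hmin hA hleast)
  have hbij := PadicWavelet.bijective_orbitIndex hA hstab
  have hpos : 0 < ∑ i ∈ C.support, ‖C i‖ ^ 2 * (p : ℝ) ^ ((A : ℤ) - i₀.scale + i.scale) :=
    Finset.sum_pos (fun i hi => mul_pos
      (pow_pos (norm_pos_iff.2 (Finsupp.mem_support_iff.1 hi)) 2)
      (zpow_pos PadicWavelet.prime_pos _)) hne
  have hsum := fun g : PadicWavelet.L2 p => PadicWavelet.hasSum_norm_inner_orbit hf hstab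
    (PadicWavelet.hasSum_norm_inner_quotient hf hC hA (fun i hi => by
      rw [← PadicWavelet.iInf_stabilizer_wavelet hi₀ hmin hA hleast]
      exact iInf₂_le i hi) g)
  refine ⟨i₀.scale, A, hγ₀, hleast, fun t t' htt' => hbij.1 (Subtype.ext htt'), ?_, ?_, ?_⟩
  · ext u
    constructor
    · rintro ⟨t, rfl⟩
      exact MulAction.mem_orbit f t.elt
    · intro hu
      obtain ⟨t, ht⟩ := hbij.2 ⟨u, hu⟩
      exact ⟨t, congrArg Subtype.val ht⟩
  · refine ⟨hpos, fun t t' => ?_, fun g => ?_⟩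
    · rw [PadicWavelet.norm_toL2_smul _ hf, PadicWavelet.norm_toL2_smul _ hf]
    · exact ((Equiv.ofBijective _ hbij).hasSum_iff).2 (hsum g)
  · refine ⟨hpos, ?_, hsum⟩
    rintro ⟨_, h, rfl⟩ ⟨_, h', rfl⟩
    exact (PadicWavelet.norm_toL2_smul h hf).trans (PadicWavelet.norm_toL2_smul h' hf).symm
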